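/- Let $\mathcal A$ be a unital $C^*$-algebra, let $M_1,M_2$ be (left) Hilbert $\mathcal A$-modules, with inner products $\langle\cdot,\cdot\rangle$ that are $\mathcal A$-linear in the first variable, and let $(\Omega_1,\mu_1)$, $(\Omega_2,\mu_2)$ be measure spaces. Let $\mu$ be a product measure of $\mu_1,\mu_2$ on $\Omega_1\times\Omega_2$ with the product $\sigma$-algebra, i.e. $\mu(E\times F)=\mu_1(E)\,\mu_2(F)$ for all measurable $E,F$. Let $M_1\otimes M_2$ be either of the following completed tensor products. (1) The exterior tensor product: the Hilbert module over the spatial tensor product $\mathcal C=\mathcal A\otimes\mathcal A$ obtained by completing the algebraic tensor product, with $\langle x\otimes y,x'\otimes y'\rangle=\langle x,x'\rangle\otimes\langle y,y'\rangle$. (2) If $\mathcal A$ is commutative: the tensor product $M_1\otimes_{\mathcal A}M_2$, a Hilbert module over $\mathcal C=\mathcal A$, with $\langle x\otimes y,x'\otimes y'\rangle=\langle x,x'\rangle\langle y,y'\rangle$. Let $X_i,Y_i:\Omega_i\to M_i$ be maps $(i=1,2)$, and put $X(\omega_1,\omega_2)=X_1(\omega_1)\otimes X_2(\omega_2)$ and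 $Y(\omega_1,\omega_2)=Y_1(\omega_1)\otimes Y_2(\omega_2)$. Suppose that $(X,Y)$ is a continuous biframe for $M_1\otimes M_2$: for all $f\in M_1$, $g\in M_2$ the functions $\langle f\otimes g,X\rangle$ and $\langle f\otimes g,Y\rangle$ are strongly measurable up to $\mu$-null sets, $\langle f\otimes g,X\rangle\langle Y,f\otimes g\rangle$ is Bochner integrable, and for some constants $0<a\le b<\infty$, not depending on $f,g$, $$a\,\langle f\otimes g,f\otimes g\rangle\le\int\langle f\otimes g,X\rangle\,\langle Y,f\otimes g\rangle\,d\mu\le b\,\langle f\otimes g,f\otimes g\rangle .$$ Suppose that the biframe operators $S_{(X_i,Y_i)}:M_i\to M_i$, $S_{(X_i,Y_i)}f=\int_{\Omega_i}\langle f,X_i\rangle Y_i\,d\mu_i$, exist as weak integrals: for all $f,g\in M_i$ the function $\langle f,X_i\rangle\langle Y_i,g\rangle$ is Bochner integrable, with integral $\langle S_{(X_i,Y_i)}f,g\rangle$. Then the biframe operator $S_{(X,Y)}$ of $(X,Y)$ exists and $$S_{(X,Y)}=S_{(X_1,Y_1)}\otimes S_{(X_2,Y_2)}.$$ That is, there is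 a bounded linear operator $T=S_{(X_1,Y_1)}\otimes S_{(X_2,Y_2)}$ on $M_1\otimes M_2$ with $T(f\otimes g)=S_{(X_1,Y_1)}f\otimes S_{(X_2,Y_2)}g$ for all $f,g$, and it is the one and only bounded linear operator $S$ on $M_1\otimes M_2$ with $S(f\otimes g)=\int\langle f\otimes g,X\rangle\,Y\,d\mu$ for all $f\in M_1$, $g\in M_2$, in the weak sense that for all $f,f'\in M_1$ and $g,g'\in M_2$ the function $\langle f\otimes g,X\rangle\langle Y,f'\otimes g'\rangle$ is Bochner integrable, with integral $\langle S(f\otimes g),f'\otimes g'\rangle$. -/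

import Mathlib

open MeasureTheory
open scoped TensorProduct

set_option linter.unusedSectionVars false

noncomputable section

/-! ### The spatial tensor product of two unital C⋆-algebras -/

section Spatial

universe u v w

variable (A : Type u) (B : Type v) [CStarAlgebra A] [CStarAlgebra B]

/-- A representation of the unital C⋆-algebra `A` on a Hilbert space. -/
structure HilbertRep where
  H : Type u
  [normed : NormedAddCommGroup H]
  [innerSpace : InnerProductSpace ℂ H]
  [complete : CompleteSpace H]
  π : A →⋆ₐ[ℂ] (H →L[ℂ] H)

attribute [instance] HilbertRep.normed HilbertRep.innerSpace HilbertRep.complete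

variable {A B}

/-- The representation, as a homomorphism into the algebra of linear endomorphisms. -/
def HilbertRep.toEnd (π : HilbertRep A) : A →ₐ[ℂ] Module.End ℂ π.H where
  toFun a := (π.π a : π.H →ₗ[ℂ] π.H)
  map_one' := by ext; simp
  map_mul' a b := by ext; simp
  map_zero' := by ext; simp
  map_add' a b := by ext; simp
  commutes' c := by ext; simp [Algebra.algebraMap_eq_smul_one]

/-- The action of the algebraic tensor product `A ⊗ B` on the inner product space `H ⊗ K`
obtained from representations of `A` on `H` and of `B` on `K`:
`(a ⊗ b) (h ⊗ k) = π a h ⊗ ρ b k`. -/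
def tensorRep (π : HilbertRep A) (ρ : HilbertRep B) :
    A ⊗[ℂ] B →ₐ[ℂ] Module.End ℂ (π.H ⊗[ℂ] ρ.H) :=
  (Module.endTensorEndAlgHom (R := ℂ) (S := ℂ) (A := ℂ)).comp
    (Algebra.TensorProduct.map π.toEnd ρ.toEnd)

theorem tensorRep_tmul (π : HilbertRep A) (ρ : HilbertRep B) (a : A) (b : B) :
    tensorRep π ρ (a ⊗ₜ b) =
      TensorProduct.map (π.π a : π.H →ₗ[ℂ] π.H) (ρ.π b : ρ.H →ₗ[ℂ] ρ.H) := rfl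

theorem tensorRep_adjoint (π : HilbertRep A) (ρ : HilbertRep B) (t : A ⊗[ℂ] B)
    (ξ η : π.H ⊗[ℂ] ρ.H) :
    inner ℂ (tensorRep π ρ t ξ) η = inner ℂ ξ (tensorRep π ρ (star t) η) := by
  induction t with
  | zero => simp
  | add s t hs ht => simp [inner_add_left, inner_add_right, hs, ht]
  | tmul a b =>
    induction ξ with
    | zero => simp
    | add ξ ξ' h h' => simp only [map_add, inner_add_left, h, h']
    | tmul x y =>
      induction η with
      | zero => simp
      | add η η' h h' => simp only [map_add, inner_add_right, h, h']
      | tmul x' y' =>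
        simp only [TensorProduct.star_tmul, tensorRep_tmul, TensorProduct.map_tmul,
          TensorProduct.inner_tmul, map_star, ContinuousLinearMap.coe_coe,
          ContinuousLinearMap.star_eq_adjoint, ContinuousLinearMap.adjoint_inner_right]

theorem tensorRep_bounded (t : A ⊗[ℂ] B) :
    ∃ C : ℝ, 0 ≤ C ∧ ∀ (π : HilbertRep A) (ρ : HilbertRep B) (ξ : π.H ⊗[ℂ] ρ.H),
      ‖tensorRep π ρ t ξ‖ ≤ C * ‖ξ‖ := by
  have key : ∀ s t : A ⊗[ℂ] B,
      (∃ C : ℝ, 0 ≤ C ∧ ∀ (π : HilbertRep A) (ρ : HilbertRep B) (ξ : π.H ⊗[ℂ] ρ.H),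
        ‖tensorRep π ρ s ξ‖ ≤ C * ‖ξ‖) →
      (∃ C : ℝ, 0 ≤ C ∧ ∀ (π : HilbertRep A) (ρ : HilbertRep B) (ξ : π.H ⊗[ℂ] ρ.H),
        ‖tensorRep π ρ t ξ‖ ≤ C * ‖ξ‖) →
      ∃ C : ℝ, 0 ≤ C ∧ ∀ (π : HilbertRep A) (ρ : HilbertRep B) (ξ : π.H ⊗[ℂ] ρ.H),
        ‖tensorRep π ρ (s + t) ξ‖ ≤ C * ‖ξ‖ := by
    rintro s t ⟨C, hC, h⟩ ⟨D, hD, h'⟩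
    refine ⟨C + D, by positivity, fun π ρ ξ => ?_⟩
    rw [map_add, LinearMap.add_apply, add_mul]
    exact (norm_add_le _ _).trans (add_le_add (h π ρ ξ) (h' π ρ ξ))
  have keyz : ∃ C : ℝ, 0 ≤ C ∧ ∀ (π : HilbertRep A) (ρ : HilbertRep B) (ξ : π.H ⊗[ℂ] ρ.H),
      ‖tensorRep π ρ 0 ξ‖ ≤ C * ‖ξ‖ := ⟨0, le_rfl, fun π ρ ξ => by simp⟩
  induction t with
  | zero => exact keyz
  | add s t hs ht => exact key s t hs ht
  | tmul a b =>
    have ha : a ∈ Submodule.span ℂ (unitary A : Set A) := by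
      rw [CStarAlgebra.span_unitary]; trivial
    have hb : b ∈ Submodule.span ℂ (unitary B : Set B) := by
      rw [CStarAlgebra.span_unitary]; trivial
    have smulk : ∀ (c : ℂ) (t : A ⊗[ℂ] B),
      (∃ C : ℝ, 0 ≤ C ∧ ∀ (π : HilbertRep A) (ρ : HilbertRep B) (ξ : π.H ⊗[ℂ] ρ.H),
        ‖tensorRep π ρ t ξ‖ ≤ C * ‖ξ‖) →
      ∃ C : ℝ, 0 ≤ C ∧ ∀ (π : HilbertRep A) (ρ : HilbertRep B) (ξ : π.H ⊗[ℂ] ρ.H),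
        ‖tensorRep π ρ (c • t) ξ‖ ≤ C * ‖ξ‖ := by
      rintro c t ⟨C, hC, h⟩
      refine ⟨‖c‖ * C, by positivity, fun π ρ ξ => ?_⟩
      rw [map_smul, LinearMap.smul_apply, norm_smul, mul_assoc]
      exact mul_le_mul_of_nonneg_left (h π ρ ξ) (norm_nonneg c)
    induction ha using Submodule.span_induction with
    | zero => simpa using keyz
    | add x y _ _ hx hy => rw [TensorProduct.add_tmul]; exact key _ _ hx hy
    | smul c x _ hx => rw [← TensorProduct.smul_tmul']; exact smulk _ _ hx
    | mem p hp =>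
      induction hb using Submodule.span_induction with
      | zero => simpa using keyz
      | add x y _ _ hx hy => rw [TensorProduct.tmul_add]; exact key _ _ hx hy
      | smul c x _ hx => rw [TensorProduct.tmul_smul]; exact smulk _ _ hx
      | mem q hq =>
        refine ⟨1, zero_le_one, fun π ρ ξ => ?_⟩
        have h1 : star (p ⊗ₜ[ℂ] q) * (p ⊗ₜ[ℂ] q) = 1 := by
          rw [TensorProduct.star_tmul, Algebra.TensorProduct.tmul_mul_tmul,
            (Unitary.mem_iff.1 hp).1, (Unitary.mem_iff.1 hq).1, Algebra.TensorProduct.one_def]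
        have h2 : ‖tensorRep π ρ (p ⊗ₜ[ℂ] q) ξ‖ ^ 2 = ‖ξ‖ ^ 2 := by
          have : inner ℂ (tensorRep π ρ (p ⊗ₜ[ℂ] q) ξ) (tensorRep π ρ (p ⊗ₜ[ℂ] q) ξ)
              = inner ℂ ξ ξ := by
            rw [tensorRep_adjoint, ← Module.End.mul_apply, ← map_mul, h1, map_one,
              Module.End.one_apply]
          have e := (inner_self_eq_norm_sq_to_K (𝕜 := ℂ) (tensorRep π ρ (p ⊗ₜ[ℂ] q) ξ)).symm.trans
            (this.trans (inner_self_eq_norm_sq_to_K (𝕜 := ℂ) ξ))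
          exact_mod_cast e
        rw [one_mul]
        exact le_of_eq ((sq_eq_sq₀ (norm_nonneg _) (norm_nonneg _)).1 h2)

/-- The spatial norm on `A ⊗ B`: the supremum of the operator norms `‖(π ⊗ ρ) t‖` over all pairs
of representations of `A` and `B` on Hilbert spaces. -/
def spatialNorm (t : A ⊗[ℂ] B) : ℝ :=
  sSup {r : ℝ | ∃ (π : HilbertRep A) (ρ : HilbertRep B) (ξ : π.H ⊗[ℂ] ρ.H),
    ‖ξ‖ ≤ 1 ∧ r = ‖tensorRep π ρ t ξ‖}

theorem spatialNorm_bddAbove (t : A ⊗[ℂ] B) :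
    BddAbove {r : ℝ | ∃ (π : HilbertRep A) (ρ : HilbertRep B) (ξ : π.H ⊗[ℂ] ρ.H),
      ‖ξ‖ ≤ 1 ∧ r = ‖tensorRep π ρ t ξ‖} := by
  obtain ⟨C, hC, h⟩ := tensorRep_bounded t
  refine ⟨C, ?_⟩
  rintro r ⟨π, ρ, ξ, hξ, rfl⟩
  exact (h π ρ ξ).trans (mul_le_of_le_one_right hC hξ)

theorem spatialNorm_nonneg (t : A ⊗[ℂ] B) : 0 ≤ spatialNorm t := by
  refine Real.sSup_nonneg ?_
  rintro r ⟨π, ρ, ξ, hξ, rfl⟩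
  exact norm_nonneg _

theorem norm_tensorRep_le (t : A ⊗[ℂ] B) (π : HilbertRep A) (ρ : HilbertRep B)
    (ξ : π.H ⊗[ℂ] ρ.H) : ‖tensorRep π ρ t ξ‖ ≤ spatialNorm t * ‖ξ‖ := by
  rcases eq_or_ne ξ 0 with rfl | hξ
  · simp
  have hpos : 0 < ‖ξ‖ := norm_pos_iff.2 hξ
  have h := le_csSup (spatialNorm_bddAbove t)
    ⟨π, ρ, ((‖ξ‖⁻¹ : ℝ) : ℂ) • ξ, by
      rw [norm_smul]; simp [hpos.ne'], rfl⟩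
  rw [map_smul, norm_smul] at h
  have h' : ‖ξ‖⁻¹ * ‖tensorRep π ρ t ξ‖ ≤ spatialNorm t := by
    simpa [spatialNorm] using h
  rwa [inv_mul_le_iff₀ hpos, mul_comm] at h'

theorem spatialNorm_le (t : A ⊗[ℂ] B) (C : ℝ) (hC : 0 ≤ C)
    (h : ∀ (π : HilbertRep A) (ρ : HilbertRep B) (ξ : π.H ⊗[ℂ] ρ.H),
      ‖tensorRep π ρ t ξ‖ ≤ C * ‖ξ‖) : spatialNorm t ≤ C := by
  refine Real.sSup_le ?_ hC
  rintro r ⟨π, ρ, ξ, hξ, rfl⟩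
  exact (h π ρ ξ).trans (mul_le_of_le_one_right hC hξ)

theorem spatialNorm_mul_le (s t : A ⊗[ℂ] B) :
    spatialNorm (s * t) ≤ spatialNorm s * spatialNorm t := by
  refine spatialNorm_le _ _ (mul_nonneg (spatialNorm_nonneg s) (spatialNorm_nonneg t)) ?_
  intro π ρ ξ
  rw [map_mul, Module.End.mul_apply, mul_assoc]
  exact (norm_tensorRep_le s π ρ _).trans
    (mul_le_mul_of_nonneg_left (norm_tensorRep_le t π ρ ξ) (spatialNorm_nonneg s))

theorem spatialNorm_sq_le (t : A ⊗[ℂ] B) :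
    spatialNorm t * spatialNorm t ≤ spatialNorm (star t * t) := by
  have h : spatialNorm t ≤ √(spatialNorm (star t * t)) := by
    refine spatialNorm_le _ _ (Real.sqrt_nonneg _) fun π ρ ξ => ?_
    have h1 : ‖tensorRep π ρ t ξ‖ ^ 2 ≤ spatialNorm (star t * t) * ‖ξ‖ ^ 2 := by
      have e : ((‖tensorRep π ρ t ξ‖ : ℂ)) ^ 2 = inner ℂ ξ (tensorRep π ρ (star t * t) ξ) := by
        rw [map_mul, Module.End.mul_apply, ← tensorRep_adjoint]
        exact (inner_self_eq_norm_sq_to_K (𝕜 := ℂ) (tensorRep π ρ t ξ)).symm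
      have this : ‖tensorRep π ρ t ξ‖ ^ 2 ≤ ‖ξ‖ * ‖tensorRep π ρ (star t * t) ξ‖ := by
        have h := norm_inner_le_norm (𝕜 := ℂ) ξ (tensorRep π ρ (star t * t) ξ)
        have h' := (congrArg norm e).le.trans h
        simpa using h'
      nlinarith [norm_tensorRep_le (star t * t) π ρ ξ, norm_nonneg ξ]
    calc ‖tensorRep π ρ t ξ‖ = √(‖tensorRep π ρ t ξ‖ ^ 2) := by simp
      _ ≤ √(spatialNorm (star t * t) * ‖ξ‖ ^ 2) := Real.sqrt_le_sqrt h1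
      _ = _ := by rw [Real.sqrt_mul (spatialNorm_nonneg _)]; simp
  calc _ ≤ √(spatialNorm (star t * t)) * √(spatialNorm (star t * t)) :=
        mul_le_mul h h (spatialNorm_nonneg t) (Real.sqrt_nonneg _)
    _ = _ := Real.mul_self_sqrt (spatialNorm_nonneg _)

theorem spatialNorm_star_le (t : A ⊗[ℂ] B) : spatialNorm (star t) ≤ spatialNorm t := by
  rcases (spatialNorm_nonneg (star t)).eq_or_lt with h | h
  · rw [← h]; exact spatialNorm_nonneg t
  have h1 := (spatialNorm_sq_le (star t)).trans (spatialNorm_mul_le _ _)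
  rw [star_star] at h1
  exact le_of_mul_le_mul_right h1 h

theorem spatialNorm_star (t : A ⊗[ℂ] B) : spatialNorm (star t) = spatialNorm t :=
  (spatialNorm_star_le t).antisymm (by simpa using spatialNorm_star_le (star t))

theorem spatialNorm_smul (c : ℂ) (t : A ⊗[ℂ] B) : spatialNorm (c • t) = ‖c‖ * spatialNorm t := by
  have hle : ∀ (c : ℂ) (t : A ⊗[ℂ] B), spatialNorm (c • t) ≤ ‖c‖ * spatialNorm t := by
    intro c t
    refine spatialNorm_le _ _ (mul_nonneg (norm_nonneg c) (spatialNorm_nonneg t)) ?_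
    intro π ρ ξ
    rw [map_smul, LinearMap.smul_apply, norm_smul, mul_assoc]
    exact mul_le_mul_of_nonneg_left (norm_tensorRep_le t π ρ ξ) (norm_nonneg c)
  refine le_antisymm (hle c t) ?_
  rcases eq_or_ne c 0 with rfl | hc
  · rw [norm_zero, zero_mul]; exact spatialNorm_nonneg _
  have h := hle c⁻¹ (c • t)
  rwa [inv_smul_smul₀ hc, norm_inv, ← div_eq_inv_mul, le_div_iff₀ (norm_pos_iff.2 hc),
    mul_comm] at h

theorem spatialNorm_add_le (s t : A ⊗[ℂ] B) :
    spatialNorm (s + t) ≤ spatialNorm s + spatialNorm t := by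
  refine spatialNorm_le _ _ (add_nonneg (spatialNorm_nonneg s) (spatialNorm_nonneg t)) ?_
  intro π ρ ξ
  rw [map_add, LinearMap.add_apply, add_mul]
  exact (norm_add_le _ _).trans
    (add_le_add (norm_tensorRep_le s π ρ ξ) (norm_tensorRep_le t π ρ ξ))

variable (A B)

/-- The algebraic tensor product `A ⊗ B`, to be equipped with the spatial norm. -/
def PreSpatial : Type (max u v) := A ⊗[ℂ] B

namespace PreSpatial

instance : Ring (PreSpatial A B) := inferInstanceAs (Ring (A ⊗[ℂ] B))
instance : Algebra ℂ (PreSpatial A B) := inferInstanceAs (Algebra ℂ (A ⊗[ℂ] B))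
instance : StarRing (PreSpatial A B) := inferInstanceAs (StarRing (A ⊗[ℂ] B))
instance : StarModule ℂ (PreSpatial A B) := inferInstanceAs (StarModule ℂ (A ⊗[ℂ] B))
instance : Norm (PreSpatial A B) := ⟨fun t => spatialNorm (A := A) (B := B) t⟩

instance : SeminormedAddCommGroup (PreSpatial A B) :=
  SeminormedAddCommGroup.ofCore (𝕜 := ℂ)
    { norm_nonneg := spatialNorm_nonneg (A := A) (B := B)
      norm_smul := spatialNorm_smul (A := A) (B := B)
      norm_triangle := spatialNorm_add_le (A := A) (B := B) }

instance : SeminormedRing (PreSpatial A B) where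
  __ := (inferInstance : SeminormedAddCommGroup (PreSpatial A B))
  __ := (inferInstance : Ring (PreSpatial A B))
  norm_mul_le := spatialNorm_mul_le (A := A) (B := B)

instance : NormedAlgebra ℂ (PreSpatial A B) where
  norm_smul_le c t := (spatialNorm_smul (A := A) (B := B) c t).le

theorem norm_star_eq (t : PreSpatial A B) : ‖star t‖ = ‖t‖ :=
  spatialNorm_star (A := A) (B := B) t

theorem norm_mul_self_le (t : PreSpatial A B) : ‖t‖ * ‖t‖ ≤ ‖star t * t‖ :=
  spatialNorm_sq_le (A := A) (B := B) t

theorem isometry_star : Isometry (star : PreSpatial A B → PreSpatial A B) :=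
  AddMonoidHomClass.isometry_of_norm (starAddEquiv (R := PreSpatial A B)) (norm_star_eq A B)

end PreSpatial

/-- The spatial tensor product `A ⊗ B`: the completion of the algebraic tensor product in the
spatial norm. -/
def SpatialTensor : Type (max u v) := UniformSpace.Completion (PreSpatial A B)

namespace SpatialTensor

open UniformSpace

instance : NormedRing (SpatialTensor A B) :=
  inferInstanceAs (NormedRing (Completion (PreSpatial A B)))
instance : CompleteSpace (SpatialTensor A B) :=
  inferInstanceAs (CompleteSpace (Completion (PreSpatial A B)))
instance : Algebra ℂ (SpatialTensor A B) :=
  inferInstanceAs (Algebra ℂ (Completion (PreSpatial A B)))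
instance : NormedAlgebra ℂ (SpatialTensor A B) where
  norm_smul_le c x := norm_smul_le c (show Completion (PreSpatial A B) from x)

variable {A B} in
/-- The canonical map of the algebraic tensor product into its completion. -/
def coe (t : A ⊗[ℂ] B) : SpatialTensor A B := Completion.coe' (α := PreSpatial A B) t

theorem denseRange_coe : DenseRange (coe : A ⊗[ℂ] B → SpatialTensor A B) :=
  Completion.denseRange_coe (α := PreSpatial A B)

instance : Star (SpatialTensor A B) :=
  ⟨Completion.map (star : PreSpatial A B → PreSpatial A B)⟩

theorem coe_star (t : A ⊗[ℂ] B) : coe (star t) = star (coe t) :=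
  (Completion.map_coe (α := PreSpatial A B) (β := PreSpatial A B)
    (PreSpatial.isometry_star A B).uniformContinuous t).symm

theorem continuous_star' : Continuous (star : SpatialTensor A B → SpatialTensor A B) :=
  Completion.continuous_map

theorem coe_mul (s t : A ⊗[ℂ] B) : coe (s * t) = coe s * coe t :=
  Completion.coe_mul (α := PreSpatial A B) s t

theorem coe_add (s t : A ⊗[ℂ] B) : coe (s + t) = coe s + coe t :=
  Completion.coe_add (α := PreSpatial A B) s t

theorem coe_smul (c : ℂ) (t : A ⊗[ℂ] B) : coe (c • t) = c • coe t :=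
  Completion.coe_smul (X := PreSpatial A B) c t

theorem norm_coe (t : A ⊗[ℂ] B) : ‖coe t‖ = spatialNorm t :=
  Completion.norm_coe (E := PreSpatial A B) t

instance : StarRing (SpatialTensor A B) where
  star_involutive x := by
    refine (denseRange_coe A B).induction_on x
      (isClosed_eq ((continuous_star' A B).comp (continuous_star' A B)) continuous_id) fun t => ?_
    rw [← coe_star, ← coe_star, star_star]
  star_mul x y := by
    refine (denseRange_coe A B).induction_on₂ (p := fun x y => star (x * y) = star y * star x)
      (isClosed_eq ((continuous_star' A B).comp continuous_mul)
        (((continuous_star' A B).comp continuous_snd).mul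
          ((continuous_star' A B).comp continuous_fst))) (fun s t => ?_) x y
    rw [← coe_mul, ← coe_star, ← coe_star, ← coe_star, star_mul, coe_mul]
  star_add x y := by
    refine (denseRange_coe A B).induction_on₂ (p := fun x y => star (x + y) = star x + star y)
      (isClosed_eq ((continuous_star' A B).comp continuous_add)
        (((continuous_star' A B).comp continuous_fst).add
          ((continuous_star' A B).comp continuous_snd))) (fun s t => ?_) x y
    rw [← coe_add, ← coe_star, ← coe_star, ← coe_star, star_add, coe_add]

instance : StarModule ℂ (SpatialTensor A B) where
  star_smul c x := by
    refine (denseRange_coe A B).induction_on x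
      (isClosed_eq ((continuous_star' A B).comp (continuous_const_smul c))
        ((continuous_const_smul (star c)).comp (continuous_star' A B))) fun t => ?_
    rw [← coe_smul, ← coe_star, ← coe_star, star_smul, coe_smul]

instance : CStarRing (SpatialTensor A B) where
  norm_mul_self_le x := by
    refine (denseRange_coe A B).induction_on x
      (isClosed_le (continuous_norm.mul continuous_norm)
        (((continuous_star' A B).mul continuous_id).norm)) fun t => ?_
    rw [← coe_star, ← coe_mul, norm_coe, norm_coe]
    exact spatialNorm_sq_le t

instance : CStarAlgebra (SpatialTensor A B) where

instance : PartialOrder (SpatialTensor A B) := CStarAlgebra.spectralOrder _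
instance : StarOrderedRing (SpatialTensor A B) := CStarAlgebra.spectralOrderedRing _

/-- The canonical ⋆-homomorphism of the algebraic tensor product into the spatial one. -/
def coeHom : A ⊗[ℂ] B →⋆ₐ[ℂ] SpatialTensor A B where
  toFun := coe
  map_one' := Completion.coe_one (PreSpatial A B)
  map_mul' := coe_mul A B
  map_zero' := Completion.coe_zero (α := PreSpatial A B)
  map_add' := coe_add A B
  commutes' _ := rfl
  map_star' := coe_star A B

instance : Fact (DenseRange (coeHom A B)) := ⟨denseRange_coe A B⟩

end SpatialTensor

end Spatial

/-! ### The tensor product of two Hilbert C⋆-modules along a ⋆-homomorphism `A ⊗ B → C` -/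

section HilbertTensor

universe u₁ u₂ u₃ v₁ v₂

section Positivity

variable {A : Type u₁} [CStarAlgebra A] [PartialOrder A] [StarOrderedRing A]
variable {M : Type v₁} [NormedAddCommGroup M] [NormedSpace ℂ M] [Module A M] [CStarModule A M]

theorem CStarAlgebra.exists_factor_or_neg {D : Type*} [CStarAlgebra D] (K : D)
    (hK : IsSelfAdjoint K) : ∃ N E : D, star N = N ∧ N * K * N = -(star E * E) ∧
      (E = 0 → ∃ F, K = star F * F) := by
  let _ := CStarAlgebra.spectralOrder D
  let _ := CStarAlgebra.spectralOrderedRing D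
  have hN0 : 0 ≤ K⁻ := CFC.negPart_nonneg K
  have hNs : star K⁻ = K⁻ := (IsSelfAdjoint.of_nonneg hN0).star_eq
  have h1 : K⁻ * K * K⁻ = -(K⁻ * K⁻ * K⁻) := by
    conv_lhs =>
      enter [1, 2]
      rw [← CFC.posPart_sub_negPart K hK]
    rw [mul_sub, CFC.negPart_mul_posPart]
    simp
  have h2 : 0 ≤ K⁻ * K⁻ * K⁻ := by
    have := star_left_conjugate_nonneg hN0 K⁻
    rwa [hNs] at this
  obtain ⟨E, hE⟩ := CStarAlgebra.nonneg_iff_eq_star_mul_self.1 h2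
  refine ⟨K⁻, E, hNs, by rw [h1, hE], fun h4 => ?_⟩
  have h5 : K⁻ * K⁻ * K⁻ = 0 := by rw [hE, h4]; simp
  have h6 : K⁻ * K⁻ = 0 := by
    rw [← CStarRing.star_mul_self_eq_zero_iff, star_mul, hNs, ← mul_assoc, h5, zero_mul]
  have h7 : K⁻ = 0 := by rw [← CStarRing.star_mul_self_eq_zero_iff, hNs, h6]
  exact CStarAlgebra.nonneg_iff_eq_star_mul_self.1 ((CFC.negPart_eq_zero_iff K hK).1 h7)

theorem CStarMatrix.factor_of_rows {ι : Type*} [Fintype ι] (K : CStarMatrix ι ι A)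
    (hK : star K = K)
    (h : ∀ a : ι → A, 0 ≤ ∑ i, ∑ j, a i * K i j * star (a j)) : ∃ F, K = star F * F := by
  classical
  obtain ⟨N, E, hNs, h1, h2⟩ := CStarAlgebra.exists_factor_or_neg K hK
  refine h2 ?_
  have h3 : ∀ k, 0 ≤ (N * K * N) k k := by
    intro k
    have e : (N * K * N) k k = ∑ i, ∑ j, N k i * K i j * star (N k j) := by
      have hs : ∀ j, star (N k j) = N j k := fun j => by
        conv_rhs => rw [← hNs]
        rfl
      simp only [hs, CStarMatrix.mul_apply, Finset.sum_mul]
      rw [Finset.sum_comm]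
    rw [e]
    exact h _
  ext l k
  have e : (star E * E) k k = ∑ i, star (E i k) * E i k := by
    rw [CStarMatrix.mul_apply]; rfl
  have hle : ∑ i, star (E i k) * E i k ≤ 0 := by
    have := h3 k
    rw [h1] at this
    have h' : (0 : A) ≤ -((star E * E) k k) := this
    rw [e] at h'
    exact neg_nonneg.1 h'
  have hz := (Finset.sum_eq_zero_iff_of_nonneg
    (fun i _ => star_mul_self_nonneg (E i k))).1
    (le_antisymm hle (Finset.sum_nonneg fun i _ => star_mul_self_nonneg (E i k))) l
    (Finset.mem_univ l)
  exact (CStarRing.star_mul_self_eq_zero_iff _).1 hz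

theorem CStarModule.gram_factor {ι : Type*} [Fintype ι] (x : ι → M) :
    ∃ E : ι → ι → A, ∀ i j, inner A (x i) (x j) = ∑ k, star (E k j) * E k i := by
  classical
  let K : CStarMatrix ι ι A := CStarMatrix.ofMatrix (Matrix.of fun i j => inner A (x j) (x i))
  obtain ⟨E, hE⟩ : ∃ F, K = star F * F := by
    refine CStarMatrix.factor_of_rows K ?_ fun a => ?_
    · ext i j
      change star (inner A (x i) (x j)) = inner A (x j) (x i)
      exact CStarModule.star_inner _ _
    · have e : ∑ i, ∑ j, a i * K i j * star (a j) = inner A (∑ j, a j • x j) (∑ i, a i • x i) := by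
        simp only [CStarModule.inner_sum_left, CStarModule.inner_sum_right,
          CStarModule.inner_op_smul_right, CStarModule.inner_op_smul_left, mul_assoc,
          Finset.mul_sum]
        rfl
      rw [e]
      exact CStarModule.inner_self_nonneg
  refine ⟨fun i j => E i j, fun i j => ?_⟩
  have : K j i = (star E * E) j i := by rw [hE]
  rw [CStarMatrix.mul_apply] at this
  exact this

theorem CStarModule.ext_inner {x y : M} (h : ∀ z : M, inner A z x = inner A z y) : x = y := by
  rw [← sub_eq_zero, ← CStarModule.inner_self (A := A), CStarModule.inner_sub_right, h, sub_self]

variable (A M) in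
/-- The left action of `A` on a Hilbert `A`-module as a `ℂ`-bilinear map. -/
def CStarModule.lsmul : A →ₗ[ℂ] M →ₗ[ℂ] M :=
  LinearMap.mk₂ ℂ (fun a x => a • x) (fun a b x => add_smul a b x)
    (fun c a x => CStarModule.ext_inner (A := A) fun z => by simp)
    (fun a x y => smul_add a x y)
    (fun c a x => CStarModule.ext_inner (A := A) fun z => by simp)

end Positivity

variable {A : Type u₁} {B : Type u₂} {C : Type u₃}
  [CStarAlgebra A] [PartialOrder A] [StarOrderedRing A]
  [CStarAlgebra B] [PartialOrder B] [StarOrderedRing B]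
  [CStarAlgebra C] [PartialOrder C] [StarOrderedRing C]
  (φ : A ⊗[ℂ] B →⋆ₐ[ℂ] C)
  (M : Type v₁) [NormedAddCommGroup M] [NormedSpace ℂ M] [Module A M] [CStarModule A M]
  (N : Type v₂) [NormedAddCommGroup N] [NormedSpace ℂ N] [Module B N] [CStarModule B N]

variable (A B) in
/-- The `A ⊗ B`-valued sesquilinear form on the algebraic tensor product `M ⊗ N`,
`⟨x ⊗ y, x' ⊗ y'⟩ = ⟨x, x'⟩ ⊗ ⟨y, y'⟩`. -/
def algInner : M ⊗[ℂ] N →ₗ⋆[ℂ] M ⊗[ℂ] N →ₗ[ℂ] A ⊗[ℂ] B :=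
  (TensorProduct.lift (TensorProduct.mapBilinear (.id ℂ) M N A B)) ∘ₛₗ
    TensorProduct.map (CStarModule.innerₛₗ (A := A)) (CStarModule.innerₛₗ (A := B))

theorem algInner_tmul (x x' : M) (y y' : N) :
    algInner A B M N (x ⊗ₜ y) (x' ⊗ₜ y') = inner A x x' ⊗ₜ inner B y y' := rfl

variable (A B) in
/-- The action of `A ⊗ B` on `M ⊗ N`, `(a ⊗ b) (x ⊗ y) = a x ⊗ b y`. -/
def algAct : A ⊗[ℂ] B →ₗ[ℂ] M ⊗[ℂ] N →ₗ[ℂ] M ⊗[ℂ] N :=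
  TensorProduct.homTensorHomMap (.id ℂ) M N M N ∘ₗ
    TensorProduct.map (CStarModule.lsmul A M) (CStarModule.lsmul B N)

theorem algAct_tmul (a : A) (b : B) (x : M) (y : N) :
    algAct A B M N (a ⊗ₜ b) (x ⊗ₜ y) = (a • x) ⊗ₜ (b • y) := rfl

theorem algInner_algAct (t : A ⊗[ℂ] B) (z w : M ⊗[ℂ] N) :
    algInner A B M N z (algAct A B M N t w) = t * algInner A B M N z w := by
  induction t with
  | zero => simp
  | add s t hs ht => simp only [map_add, LinearMap.add_apply, hs, ht, add_mul]
  | tmul a b =>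
    induction z with
    | zero => simp
    | add z z' h h' => simp only [map_add, LinearMap.add_apply, h, h', mul_add]
    | tmul x y =>
      induction w with
      | zero => simp
      | add w w' h h' => simp only [map_add, h, h', mul_add]
      | tmul x' y' => simp [algAct_tmul, algInner_tmul]

theorem star_algInner (z w : M ⊗[ℂ] N) :
    star (algInner A B M N z w) = algInner A B M N w z := by
  induction z with
  | zero => simp
  | add z z' h h' => simp only [map_add, LinearMap.add_apply, h, h', star_add]
  | tmul x y =>
    induction w with
    | zero => simp
    | add w w' h h' => simp only [map_add, LinearMap.add_apply, h, h', star_add]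
    | tmul x' y' => simp [algInner_tmul]

theorem map_algInner_self_nonneg (z : M ⊗[ℂ] N) : 0 ≤ φ (algInner A B M N z z) := by
  obtain ⟨S, rfl⟩ := TensorProduct.exists_finset z
  obtain ⟨E, hE⟩ := CStarModule.gram_factor (A := A) (fun i : S => i.1.1)
  obtain ⟨F, hF⟩ := CStarModule.gram_factor (A := B) (fun i : S => i.1.2)
  have e : algInner A B M N (∑ i ∈ S, i.1 ⊗ₜ i.2) (∑ i ∈ S, i.1 ⊗ₜ i.2) =
      ∑ k : S, ∑ l : S, star (∑ j : S, E k j ⊗ₜ[ℂ] F l j) * (∑ i : S, E k i ⊗ₜ[ℂ] F l i) := by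
    rw [← Finset.sum_coe_sort S]
    simp only [map_sum, LinearMap.sum_apply, algInner_tmul, hE, hF]
    simp only [star_sum, TensorProduct.star_tmul]
    simp_rw [Finset.sum_mul_sum, Algebra.TensorProduct.tmul_mul_tmul, TensorProduct.sum_tmul,
      TensorProduct.tmul_sum]
    rw [Finset.sum_congr rfl fun i _ => Finset.sum_comm]
    rw [Finset.sum_comm]
    refine Finset.sum_congr rfl fun k _ => ?_
    rw [Finset.sum_congr rfl fun i _ => Finset.sum_comm]
    rw [Finset.sum_comm]
  rw [e]
  simp only [map_sum φ]
  refine Finset.sum_nonneg fun k _ => Finset.sum_nonneg fun l _ => ?_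
  rw [map_mul, map_star]
  exact star_mul_self_nonneg _


/-- The algebraic tensor product `M ⊗ N` over `ℂ`, to be equipped with the `C`-valued
semi-inner product `φ ⟨z, w⟩`. -/
def PreHilbertTensor (_φ : A ⊗[ℂ] B →⋆ₐ[ℂ] C) (M : Type v₁) [NormedAddCommGroup M]
    [NormedSpace ℂ M] (N : Type v₂) [NormedAddCommGroup N] [NormedSpace ℂ N] : Type (max v₁ v₂) :=
  M ⊗[ℂ] N

namespace PreHilbertTensor

instance : AddCommGroup (PreHilbertTensor φ M N) := inferInstanceAs (AddCommGroup (M ⊗[ℂ] N))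
instance : Module ℂ (PreHilbertTensor φ M N) := inferInstanceAs (Module ℂ (M ⊗[ℂ] N))

/-- The `C`-valued semi-inner product `φ ⟨z, w⟩`. -/
def form : PreHilbertTensor φ M N →ₗ⋆[ℂ] PreHilbertTensor φ M N →ₗ[ℂ] C :=
  (algInner A B M N).compr₂ₛₗ (φ : A ⊗[ℂ] B →ₗ[ℂ] C)

theorem form_apply (z w : PreHilbertTensor φ M N) :
    form φ M N z w = φ (algInner A B M N z w) := rfl

theorem form_self_nonneg (z : PreHilbertTensor φ M N) : 0 ≤ form φ M N z z :=
  map_algInner_self_nonneg φ M N z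

theorem star_form (z w : PreHilbertTensor φ M N) : star (form φ M N z w) = form φ M N w z := by
  rw [form_apply, form_apply, ← map_star]
  exact congrArg φ (star_algInner M N z w)

instance : Norm (PreHilbertTensor φ M N) := ⟨fun z => √‖form φ M N z z‖⟩

theorem norm_def (z : PreHilbertTensor φ M N) : ‖z‖ = √‖form φ M N z z‖ := rfl

theorem norm_sq (z : PreHilbertTensor φ M N) : ‖z‖ ^ 2 = ‖form φ M N z z‖ :=
  Real.sq_sqrt (norm_nonneg _)

theorem norm_nonneg' (z : PreHilbertTensor φ M N) : 0 ≤ ‖z‖ := Real.sqrt_nonneg _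

theorem norm_form_add_le (z w : PreHilbertTensor φ M N) (r : ℝ) (hr : 0 < r) :
    ‖z + w‖ ^ 2 ≤ (1 + r) * ‖z‖ ^ 2 + (1 + r⁻¹) * ‖w‖ ^ 2 := by
  have h0 : form φ M N (z + w) (z + w) ≤
      (1 + r) • form φ M N z z + (1 + r⁻¹) • form φ M N w w := by
    have h := form_self_nonneg φ M N (((√r : ℝ) : ℂ) • z - (((√r)⁻¹ : ℝ) : ℂ) • w)
    have hs : (√r : ℝ) ≠ 0 := (Real.sqrt_pos.2 hr).ne'
    have e : form φ M N (((√r : ℝ) : ℂ) • z - (((√r)⁻¹ : ℝ) : ℂ) • w)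
        (((√r : ℝ) : ℂ) • z - (((√r)⁻¹ : ℝ) : ℂ) • w) =
        r • form φ M N z z + r⁻¹ • form φ M N w w - form φ M N z w - form φ M N w z := by
      simp only [map_sub, map_smulₛₗ, LinearMap.sub_apply, LinearMap.smul_apply,
        Complex.conj_ofReal, smul_smul, RingHom.id_apply, smul_sub, ← Complex.ofReal_mul,
        Real.mul_self_sqrt hr.le, mul_inv_cancel₀ hs, inv_mul_cancel₀ hs, ← mul_inv]
      simp only [Complex.coe_smul, one_smul]
      abel
    rw [e] at h
    rw [← sub_nonneg]
    refine h.trans_eq ?_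
    simp only [map_add, LinearMap.add_apply, add_smul, one_smul]
    abel
  have h1 := CStarAlgebra.norm_le_norm_of_nonneg_of_le (form_self_nonneg φ M N (z + w)) h0
  rw [norm_sq, norm_sq, norm_sq]
  refine h1.trans ((norm_add_le _ _).trans ?_)
  rw [norm_smul, norm_smul, Real.norm_of_nonneg (by positivity), Real.norm_of_nonneg (by positivity)]

theorem norm_add_le' (z w : PreHilbertTensor φ M N) : ‖z + w‖ ≤ ‖z‖ + ‖w‖ := by
  have ha := norm_nonneg' φ M N z
  have hb := norm_nonneg' φ M N w
  refine le_of_forall_pos_le_add fun ε hε => ?_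
  set a := ‖z‖ + ε / 2
  set b := ‖w‖ + ε / 2
  have ha' : 0 < a := by positivity
  have hb' : 0 < b := by positivity
  have h := norm_form_add_le φ M N z w (b / a) (by positivity)
  have h2 : ‖z + w‖ ^ 2 ≤ (a + b) ^ 2 := by
    refine h.trans ?_
    have e : (a + b) ^ 2 = (1 + b / a) * a ^ 2 + (1 + (b / a)⁻¹) * b ^ 2 := by
      field_simp
      ring
    rw [e]
    have : ‖z‖ ≤ a := by simp only [a]; linarith
    have : ‖w‖ ≤ b := by simp only [b]; linarith
    gcongr
  have := abs_le_of_sq_le_sq' h2 (by positivity)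
  have := this.2
  simp only [a, b] at this
  linarith

theorem norm_smul' (c : ℂ) (z : PreHilbertTensor φ M N) : ‖c • z‖ = ‖c‖ * ‖z‖ := by
  rw [norm_def, norm_def, map_smulₛₗ, map_smulₛₗ, LinearMap.smul_apply, norm_smul, norm_smul]
  simp [← mul_assoc]

instance : SeminormedAddCommGroup (PreHilbertTensor φ M N) :=
  SeminormedAddCommGroup.ofCore (𝕜 := ℂ)
    { norm_nonneg := norm_nonneg' φ M N
      norm_smul := norm_smul' φ M N
      norm_triangle := norm_add_le' φ M N }

instance : NormedSpace ℂ (PreHilbertTensor φ M N) where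
  norm_smul_le c z := (norm_smul' φ M N c z).le

theorem norm_form_le (z w : PreHilbertTensor φ M N) : ‖form φ M N z w‖ ≤ 4 * ‖z‖ * ‖w‖ := by
  have h1 : ∀ z w : PreHilbertTensor φ M N, ‖form φ M N z w‖ ≤ (‖z‖ + ‖w‖) ^ 2 := by
    intro z w
    have e : (4 : ℂ) • form φ M N z w = form φ M N (z + w) (z + w) - form φ M N (z - w) (z - w)
        - Complex.I • form φ M N (z + Complex.I • w) (z + Complex.I • w)
        + Complex.I • form φ M N (z - Complex.I • w) (z - Complex.I • w) := by
      simp only [map_add, map_sub, map_smulₛₗ, LinearMap.add_apply, LinearMap.sub_apply,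
        LinearMap.smul_apply, smul_add, smul_sub, smul_smul, RingHom.id_apply, Complex.conj_I]
      simp only [mul_neg, Complex.I_mul_I]
      module
    have b : ∀ v : PreHilbertTensor φ M N, ‖v‖ ≤ ‖z‖ + ‖w‖ →
        ‖form φ M N v v‖ ≤ (‖z‖ + ‖w‖) ^ 2 := by
      intro v hv
      rw [← norm_sq]
      exact pow_le_pow_left₀ (norm_nonneg v) hv 2
    have hI : ‖Complex.I • w‖ = ‖w‖ := by rw [norm_smul]; simp
    have b1 := b (z + w) (norm_add_le _ _)
    have b2 := b (z - w) (norm_sub_le _ _)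
    have b3 := b (z + Complex.I • w) ((norm_add_le _ _).trans_eq (by rw [hI]))
    have b4 := b (z - Complex.I • w) ((norm_sub_le _ _).trans_eq (by rw [hI]))
    have h := congrArg norm e
    rw [norm_smul] at h
    have h' : ‖(4 : ℂ)‖ = 4 := by simp
    rw [h'] at h
    have n1 := norm_add_le (form φ M N (z + w) (z + w) - form φ M N (z - w) (z - w)
        - Complex.I • form φ M N (z + Complex.I • w) (z + Complex.I • w))
      (Complex.I • form φ M N (z - Complex.I • w) (z - Complex.I • w))
    have n2 := norm_sub_le (form φ M N (z + w) (z + w) - form φ M N (z - w) (z - w))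
      (Complex.I • form φ M N (z + Complex.I • w) (z + Complex.I • w))
    have n3 := norm_sub_le (form φ M N (z + w) (z + w)) (form φ M N (z - w) (z - w))
    rw [norm_smul, Complex.norm_I, one_mul] at n1 n2
    linarith
  refine le_of_forall_pos_le_add fun ε hε => ?_
  have h2 : ∀ δ : ℝ, 0 < δ → ‖form φ M N z w‖ ≤ 4 * ((‖z‖ + δ) * (‖w‖ + δ)) := by
    intro δ hδ
    set a := ‖z‖ + δ with ha
    set b := ‖w‖ + δ with hb
    have ha' : 0 < a := by positivity
    have hb' : 0 < b := by positivity
    have h := h1 (((a⁻¹ : ℝ) : ℂ) • z) (((b⁻¹ : ℝ) : ℂ) • w)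
    rw [norm_smul, norm_smul, map_smulₛₗ, map_smulₛₗ, LinearMap.smul_apply, norm_smul,
      norm_smul] at h
    simp only [Complex.conj_ofReal, Complex.norm_real, norm_inv, Real.norm_of_nonneg ha'.le,
      Real.norm_of_nonneg hb'.le, RingHom.id_apply] at h
    have hz : a⁻¹ * ‖z‖ ≤ 1 := by
      rw [inv_mul_le_iff₀ ha', mul_one, ha]; linarith
    have hw : b⁻¹ * ‖w‖ ≤ 1 := by
      rw [inv_mul_le_iff₀ hb', mul_one, hb]; linarith
    have hle : (a⁻¹ * ‖z‖ + b⁻¹ * ‖w‖) ^ 2 ≤ 4 := by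
      have : 0 ≤ a⁻¹ * ‖z‖ + b⁻¹ * ‖w‖ := by positivity
      nlinarith
    have h3 := h.trans hle
    have e : ‖form φ M N z w‖ = (a * b) * (b⁻¹ * (a⁻¹ * ‖form φ M N z w‖)) := by
      field_simp
    rw [e, mul_comm 4]
    refine mul_le_mul_of_nonneg_left ?_ (by positivity)
    convert h3 using 1
  have hc : Filter.Tendsto (fun δ : ℝ => 4 * ((‖z‖ + δ) * (‖w‖ + δ)))
      (nhdsWithin 0 (Set.Ioi 0)) (nhds (4 * ((‖z‖ + 0) * (‖w‖ + 0)))) := by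
    refine Filter.Tendsto.mono_left ?_ nhdsWithin_le_nhds
    exact (by fun_prop : Continuous fun δ : ℝ => 4 * ((‖z‖ + δ) * (‖w‖ + δ))).tendsto 0
  have h3 := ge_of_tendsto hc (Filter.eventually_of_mem self_mem_nhdsWithin fun δ hδ => h2 δ hδ)
  simp only [add_zero] at h3
  linarith

/-- The action of `A ⊗ B` on `M ⊗ N`. -/
def act : A ⊗[ℂ] B →ₗ[ℂ] PreHilbertTensor φ M N →ₗ[ℂ] PreHilbertTensor φ M N :=
  algAct A B M N

theorem form_act (t : A ⊗[ℂ] B) (z w : PreHilbertTensor φ M N) :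
    form φ M N z (act φ M N t w) = φ t * form φ M N z w := by
  rw [form_apply, form_apply, ← map_mul]
  exact congrArg φ (algInner_algAct M N t z w)

theorem norm_act_le (t : A ⊗[ℂ] B) (z : PreHilbertTensor φ M N) :
    ‖act φ M N t z‖ ≤ ‖φ t‖ * ‖z‖ := by
  have e : form φ M N (act φ M N t z) (act φ M N t z) = φ t * form φ M N z z * star (φ t) := by
    rw [form_act, ← star_form, form_act, star_mul, star_form, mul_assoc]
  have h : ‖act φ M N t z‖ ^ 2 ≤ (‖φ t‖ * ‖z‖) ^ 2 := by
    rw [norm_sq, e, mul_pow, norm_sq]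
    refine (norm_mul_le _ _).trans ?_
    rw [norm_star]
    have := norm_mul_le (φ t) (form φ M N z z)
    nlinarith [norm_nonneg (φ t)]
  exact le_of_sq_le_sq h (by positivity)

end PreHilbertTensor

/-- The completed tensor product of the Hilbert `A`-module `M` and the Hilbert `B`-module `N` along
`φ : A ⊗ B → C`: the (separated) completion of the algebraic tensor product in the norm
`‖φ ⟨z, z⟩‖ ^ (1 / 2)`. -/
def HilbertTensor : Type (max v₁ v₂) := UniformSpace.Completion (PreHilbertTensor φ M N)

namespace HilbertTensor

open UniformSpace

instance : NormedAddCommGroup (HilbertTensor φ M N) :=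
  inferInstanceAs (NormedAddCommGroup (Completion (PreHilbertTensor φ M N)))
instance : NormedSpace ℂ (HilbertTensor φ M N) :=
  inferInstanceAs (NormedSpace ℂ (Completion (PreHilbertTensor φ M N)))
instance : CompleteSpace (HilbertTensor φ M N) :=
  inferInstanceAs (CompleteSpace (Completion (PreHilbertTensor φ M N)))

/-- The canonical map of the algebraic tensor product into its completion. -/
def ι : PreHilbertTensor φ M N →ₗ[ℂ] HilbertTensor φ M N :=
  (Completion.toComplₗᵢ (𝕜 := ℂ) (E := PreHilbertTensor φ M N)).toLinearMap

theorem norm_ι (z : PreHilbertTensor φ M N) : ‖ι φ M N z‖ = ‖z‖ := Completion.norm_coe z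

theorem denseRange_ι : DenseRange (ι φ M N) :=
  Completion.denseRange_coe (α := PreHilbertTensor φ M N)

variable {M N} in
/-- The elementary tensor `x ⊗ y`. -/
def tmul (x : M) (y : N) : HilbertTensor φ M N :=
  ι φ M N (show PreHilbertTensor φ M N from x ⊗ₜ[ℂ] y)

variable {φ M N} in
theorem ext_ι {F : Type*} [NormedAddCommGroup F] [NormedSpace ℂ F]
    {f g : HilbertTensor φ M N →L[ℂ] F} (h : ∀ z, f (ι φ M N z) = g (ι φ M N z)) : f = g :=
  DFunLike.coe_injective ((denseRange_ι φ M N).equalizer f.continuous g.continuous (funext h))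

theorem form_bound (z w : PreHilbertTensor φ M N) :
    ‖PreHilbertTensor.form φ M N z w‖ ≤ 4 * ‖z‖ * ‖ι φ M N w‖ := by
  rw [norm_ι]
  exact PreHilbertTensor.norm_form_le φ M N z w

/-- For fixed `z`, the form `⟨z, ·⟩` extended to the completion. -/
def formAt (z : PreHilbertTensor φ M N) : HilbertTensor φ M N →L[ℂ] C :=
  (PreHilbertTensor.form φ M N z).extendOfNorm (ι φ M N)

theorem formAt_ι (z w : PreHilbertTensor φ M N) :
    formAt φ M N z (ι φ M N w) = PreHilbertTensor.form φ M N z w :=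
  LinearMap.extendOfNorm_eq (denseRange_ι φ M N) ⟨_, form_bound φ M N z⟩ w

/-- The map `z ↦ ⟨z, ·⟩` on the algebraic tensor product. -/
def formAux : PreHilbertTensor φ M N →ₗ⋆[ℂ] HilbertTensor φ M N →L[ℂ] C where
  toFun := formAt φ M N
  map_add' z z' := ext_ι fun w => by
    simp only [add_apply, formAt_ι, map_add, LinearMap.add_apply]
  map_smul' c z := ext_ι fun w => by
    simp only [smul_apply, formAt_ι, map_smulₛₗ, LinearMap.smul_apply]

theorem norm_formAux_le (z : PreHilbertTensor φ M N) :
    ‖formAux φ M N z‖ ≤ 4 * ‖ι φ M N z‖ := by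
  rw [norm_ι]
  exact LinearMap.opNorm_extendOfNorm_le (denseRange_ι φ M N) (by positivity) (form_bound φ M N z)

/-- The `C`-valued inner product on the completion. -/
def form : HilbertTensor φ M N →L⋆[ℂ] HilbertTensor φ M N →L[ℂ] C :=
  (formAux φ M N).extendOfNorm (ι φ M N)

theorem form_ι (z w : PreHilbertTensor φ M N) :
    form φ M N (ι φ M N z) (ι φ M N w) = PreHilbertTensor.form φ M N z w := by
  have h : form φ M N (ι φ M N z) = formAt φ M N z :=
    LinearMap.extendOfNorm_eq (denseRange_ι φ M N) ⟨4, norm_formAux_le φ M N⟩ z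
  rw [h, formAt_ι]

theorem act_bound (t : A ⊗[ℂ] B) (z : PreHilbertTensor φ M N) :
    ‖(ι φ M N ∘ₗ PreHilbertTensor.act φ M N t) z‖ ≤ ‖φ t‖ * ‖ι φ M N z‖ := by
  rw [LinearMap.comp_apply, norm_ι, norm_ι]
  exact PreHilbertTensor.norm_act_le φ M N t z

/-- The action of an element of `A ⊗ B` on the completion. -/
def actAt (t : A ⊗[ℂ] B) : HilbertTensor φ M N →L[ℂ] HilbertTensor φ M N :=
  (ι φ M N ∘ₗ PreHilbertTensor.act φ M N t).extendOfNorm (ι φ M N)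

theorem actAt_ι (t : A ⊗[ℂ] B) (z : PreHilbertTensor φ M N) :
    actAt φ M N t (ι φ M N z) = ι φ M N (PreHilbertTensor.act φ M N t z) :=
  LinearMap.extendOfNorm_eq (denseRange_ι φ M N) ⟨_, act_bound φ M N t⟩ z

/-- The action of `A ⊗ B` on the completion. -/
def actAux : A ⊗[ℂ] B →ₗ[ℂ] HilbertTensor φ M N →L[ℂ] HilbertTensor φ M N where
  toFun := actAt φ M N
  map_add' s t := ext_ι fun w => by
    simp only [add_apply, actAt_ι, map_add, LinearMap.add_apply]
  map_smul' c t := ext_ι fun w => by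
    simp only [smul_apply, actAt_ι, map_smul, LinearMap.smul_apply,
      RingHom.id_apply]

theorem norm_actAux_le (t : A ⊗[ℂ] B) :
    ‖actAux φ M N t‖ ≤ 1 * ‖(φ : A ⊗[ℂ] B →ₗ[ℂ] C) t‖ := by
  rw [one_mul]
  exact LinearMap.opNorm_extendOfNorm_le (denseRange_ι φ M N) (norm_nonneg _) (act_bound φ M N t)

/-- The action of `C` on the completion: the continuous extension of the action of `A ⊗ B`
(for `φ` with dense range). -/
def act : C →L[ℂ] HilbertTensor φ M N →L[ℂ] HilbertTensor φ M N :=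
  (actAux φ M N).extendOfNorm (φ : A ⊗[ℂ] B →ₗ[ℂ] C)

theorem act_apply_ι [hφ : Fact (DenseRange φ)] (t : A ⊗[ℂ] B) (z : PreHilbertTensor φ M N) :
    act φ M N (φ t) (ι φ M N z) = ι φ M N (PreHilbertTensor.act φ M N t z) := by
  have h : act φ M N (φ t) = actAt φ M N t :=
    LinearMap.extendOfNorm_eq (e := (φ : A ⊗[ℂ] B →ₗ[ℂ] C)) hφ.out ⟨1, norm_actAux_le φ M N⟩ t
  rw [h, actAt_ι]

instance : Inner C (HilbertTensor φ M N) := ⟨fun z w => form φ M N z w⟩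

theorem inner_def (z w : HilbertTensor φ M N) : inner C z w = form φ M N z w := rfl

theorem inner_tmul (x x' : M) (y y' : N) :
    inner C (tmul φ x y) (tmul φ x' y') = φ (inner A x x' ⊗ₜ inner B y y') :=
  form_ι φ M N _ _

theorem continuous_form {X : Type*} [TopologicalSpace X] {f g : X → HilbertTensor φ M N}
    (hf : Continuous f) (hg : Continuous g) : Continuous fun x => form φ M N (f x) (g x) :=
  ((form φ M N).continuous.comp hf).clm_apply hg

theorem form_act [hφ : Fact (DenseRange φ)] (c : C) (z w : HilbertTensor φ M N) :
    form φ M N z (act φ M N c w) = c * form φ M N z w := by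
  refine hφ.out.induction_on c (isClosed_eq ?_ ?_) fun t => ?_
  · exact continuous_form φ M N continuous_const
      ((act φ M N).continuous.clm_apply continuous_const)
  · exact continuous_id.mul continuous_const
  refine (denseRange_ι φ M N).induction_on₂
    (p := fun z w => form φ M N z (act φ M N (φ t) w) = φ t * form φ M N z w)
    (isClosed_eq ?_ ?_) (fun z w => ?_) z w
  · exact continuous_form φ M N continuous_fst ((act φ M N (φ t)).continuous.comp continuous_snd)
  · exact continuous_const.mul (continuous_form φ M N continuous_fst continuous_snd)
  · rw [act_apply_ι, form_ι, form_ι, PreHilbertTensor.form_act]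

theorem star_form (z w : HilbertTensor φ M N) : star (form φ M N z w) = form φ M N w z := by
  refine (denseRange_ι φ M N).induction_on₂
    (p := fun z w => star (form φ M N z w) = form φ M N w z)
    (isClosed_eq ?_ ?_) (fun z w => ?_) z w
  · exact (continuous_form φ M N continuous_fst continuous_snd).star
  · exact continuous_form φ M N continuous_snd continuous_fst
  · rw [form_ι, form_ι, PreHilbertTensor.star_form]

theorem form_self_nonneg (z : HilbertTensor φ M N) : 0 ≤ form φ M N z z := by
  refine (denseRange_ι φ M N).induction_on z (isClosed_le continuous_const
    (continuous_form φ M N continuous_id continuous_id)) fun z => ?_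
  rw [form_ι]
  exact PreHilbertTensor.form_self_nonneg φ M N z

theorem norm_eq (z : HilbertTensor φ M N) : ‖z‖ = √‖form φ M N z z‖ := by
  refine (denseRange_ι φ M N).induction_on z (isClosed_eq continuous_norm
    (Real.continuous_sqrt.comp
      (continuous_form φ M N continuous_id continuous_id).norm)) fun z => ?_
  rw [form_ι, norm_ι, PreHilbertTensor.norm_def]

theorem form_self_eq_zero {z : HilbertTensor φ M N} : form φ M N z z = 0 ↔ z = 0 :=
  ⟨fun h => by rw [← norm_eq_zero, norm_eq, h, norm_zero, Real.sqrt_zero], fun h => by simp [h]⟩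

theorem ext_form {z w : HilbertTensor φ M N} (h : ∀ v, form φ M N v z = form φ M N v w) :
    z = w := by
  rw [← sub_eq_zero, ← form_self_eq_zero φ M N, map_sub (form φ M N (z - w)), h, sub_self]

instance [Fact (DenseRange φ)] : Module C (HilbertTensor φ M N) where
  smul c z := act φ M N c z
  one_smul z := ext_form φ M N fun v => (form_act φ M N 1 v z).trans (one_mul _)
  mul_smul c d z := ext_form φ M N fun v => by
    refine (form_act φ M N (c * d) v z).trans ?_
    refine Eq.trans ?_ (form_act φ M N c v (act φ M N d z)).symm
    rw [form_act, mul_assoc]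
  smul_zero c := map_zero (act φ M N c)
  smul_add c := map_add (act φ M N c)
  add_smul c d z := by
    change act φ M N (c + d) z = act φ M N c z + act φ M N d z
    rw [map_add, add_apply]
  zero_smul z := by
    change act φ M N 0 z = 0
    rw [map_zero, zero_apply]

/-- The completed tensor product is a Hilbert `C`-module. -/
instance [Fact (DenseRange φ)] : CStarModule C (HilbertTensor φ M N) where
  inner_add_right := map_add (form φ M N _) _ _
  inner_self_nonneg := form_self_nonneg φ M N _
  inner_self := form_self_eq_zero φ M N
  inner_op_smul_right := form_act φ M N _ _ _
  inner_smul_right_complex := map_smul (form φ M N _) _ _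
  star_inner := star_form φ M N
  norm_eq_sqrt_norm_inner_self := norm_eq φ M N

theorem smul_tmul [Fact (DenseRange φ)] (a : A) (b : B) (x : M) (y : N) :
    φ (a ⊗ₜ b) • tmul φ x y = tmul φ (a • x) (b • y) :=
  act_apply_ι φ M N (a ⊗ₜ b) _

end HilbertTensor

end HilbertTensor

/-! ### Commutative coefficients: the tensor product `M ⊗_A N` with `A`-valued inner product -/

section Balanced

universe u v₁ v₂

variable {A : Type u} [CStarAlgebra A] [PartialOrder A] [StarOrderedRing A]

/-- For commutative `A`, the multiplication `a ⊗ b ↦ a b` as an algebra homomorphism. -/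
def mulAlgHom (hA : ∀ a b : A, a * b = b * a) : A ⊗[ℂ] A →ₐ[ℂ] A :=
  Algebra.TensorProduct.lift (AlgHom.id ℂ A) (AlgHom.id ℂ A) fun a b =>
    show Commute (AlgHom.id ℂ A a) (AlgHom.id ℂ A b) from hA a b

theorem mulAlgHom_tmul (hA : ∀ a b : A, a * b = b * a) (a b : A) :
    mulAlgHom hA (a ⊗ₜ b) = a * b :=
  Algebra.TensorProduct.lift_tmul _ _ _ a b

/-- For commutative `A`, the multiplication `a ⊗ b ↦ a b` as a ⋆-homomorphism `A ⊗ A → A`. -/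
def mulHom (hA : ∀ a b : A, a * b = b * a) : A ⊗[ℂ] A →⋆ₐ[ℂ] A where
  toAlgHom := mulAlgHom hA
  map_star' t := by
    change mulAlgHom hA (star t) = star (mulAlgHom hA t)
    induction t with
    | zero => simp
    | add s t hs ht => rw [star_add, map_add, map_add, star_add, hs, ht]
    | tmul a b =>
      rw [TensorProduct.star_tmul, mulAlgHom_tmul, mulAlgHom_tmul, star_mul, hA (star b)]

theorem mulHom_tmul (hA : ∀ a b : A, a * b = b * a) (a b : A) : mulHom hA (a ⊗ₜ b) = a * b :=
  mulAlgHom_tmul hA a b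

instance (hA : ∀ a b : A, a * b = b * a) : Fact (DenseRange (mulHom hA)) :=
  ⟨Function.Surjective.denseRange fun a => ⟨a ⊗ₜ 1, by rw [mulHom_tmul, mul_one]⟩⟩

variable (M : Type v₁) [NormedAddCommGroup M] [NormedSpace ℂ M] [Module A M] [CStarModule A M]
  (N : Type v₂) [NormedAddCommGroup N] [NormedSpace ℂ N] [Module A N] [CStarModule A N]

variable (A) in
/-- The exterior tensor product `M ⊗ N` of two Hilbert `A`-modules, a Hilbert module over the
spatial tensor product `A ⊗ A`, with `⟨x ⊗ y, x' ⊗ y'⟩ = ⟨x, x'⟩ ⊗ ⟨y, y'⟩`. -/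
abbrev ExteriorTensor := HilbertTensor (SpatialTensor.coeHom A A) M N

/-- For commutative `A`, the tensor product `M ⊗_A N` of two Hilbert `A`-modules, a Hilbert
`A`-module with `⟨x ⊗ y, x' ⊗ y'⟩ = ⟨x, x'⟩ ⟨y, y'⟩`. Completing `M ⊗ N` also identifies
`a x ⊗ y` with `x ⊗ a y`. -/
abbrev BalancedTensor (hA : ∀ a b : A, a * b = b * a) := HilbertTensor (mulHom hA) M N

variable {M N} in
theorem BalancedTensor.smul_tmul (hA : ∀ a b : A, a * b = b * a) (a : A) (x : M) (y : N) :
    HilbertTensor.tmul (mulHom hA) (a • x) y = HilbertTensor.tmul (mulHom hA) x (a • y) := by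
  have h1 := HilbertTensor.smul_tmul (mulHom hA) M N a 1 x y
  have h2 := HilbertTensor.smul_tmul (mulHom hA) M N 1 a x y
  rw [mulHom_tmul, one_smul] at h1 h2
  rw [← h1, ← h2, mul_one, one_mul]

end Balanced

/-! ### Continuous biframes and their operators -/

section Biframe

universe u v w

variable (A : Type u) [CStarAlgebra A] [PartialOrder A] [StarOrderedRing A]
  {E : Type v} [NormedAddCommGroup E] [NormedSpace ℂ E] [Module A E] [CStarModule A E]
  {Ω : Type w} [MeasurableSpace Ω]

/-- The inner product of a left Hilbert `A`-module, `A`-linear in the first variable: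
`⟨a x + y, z⟩ = a ⟨x, z⟩ + ⟨y, z⟩`. -/
def lip (x y : E) : A := inner A y x

/-- `(X, Y)` is a continuous biframe, tested on the elements of `D`: for `f ∈ D` the functions
`⟨f, X⟩`, `⟨f, Y⟩` are measurable and
`a ⟨f, f⟩ ≤ ∫ ⟨f, X⟩ ⟨Y, f⟩ dμ ≤ b ⟨f, f⟩`, with constants `0 < a ≤ b`. For a single Hilbert module
`D` is the whole module, for a tensor product it is the set of elementary tensors. -/
structure IsBiframeOn (D : Set E) (X Y : Ω → E) (μ : Measure Ω) : Prop where
  measurable_left : ∀ f ∈ D, AEStronglyMeasurable (fun ω => lip A f (X ω)) μ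
  measurable_right : ∀ f ∈ D, AEStronglyMeasurable (fun ω => lip A f (Y ω)) μ
  integrable : ∀ f ∈ D, Integrable (fun ω => lip A f (X ω) * lip A (Y ω) f) μ
  bounds : ∃ a b : ℝ, 0 < a ∧ a ≤ b ∧ ∀ f ∈ D,
    a • lip A f f ≤ ∫ ω, lip A f (X ω) * lip A (Y ω) f ∂μ ∧
    ∫ ω, lip A f (X ω) * lip A (Y ω) f ∂μ ≤ b • lip A f f

/-- `S f = ∫ ⟨f, X ω⟩ Y ω dμ(ω)` for all `f ∈ D`, as a weak integral tested on `D`: for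
`f, g ∈ D` the function `ω ↦ ⟨⟨f, X ω⟩ Y ω, g⟩` is integrable, with integral `⟨S f, g⟩`. -/
def IsBiframeOperatorOn (D : Set E) (X Y : Ω → E) (μ : Measure Ω) (S : E → E) : Prop :=
  ∀ f ∈ D, ∀ g ∈ D, Integrable (fun ω => lip A (lip A f (X ω) • Y ω) g) μ ∧
    lip A (S f) g = ∫ ω, lip A (lip A f (X ω) • Y ω) g ∂μ

/-- `S` is the biframe operator `f ↦ ∫ ⟨f, X ω⟩ Y ω dμ(ω)` of `(X, Y)` on a Hilbert module. -/
def IsBiframeOperator (X Y : Ω → E) (μ : Measure Ω) (S : E → E) : Prop :=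
  IsBiframeOperatorOn A Set.univ X Y μ S

end Biframe

section BiframeTensor

universe u₁ u₂ u₃ v₁ v₂ w

variable {A : Type u₁} {B : Type u₂} {C : Type u₃}
  [CStarAlgebra A] [PartialOrder A] [StarOrderedRing A]
  [CStarAlgebra B] [PartialOrder B] [StarOrderedRing B]
  [CStarAlgebra C] [PartialOrder C] [StarOrderedRing C]
  (φ : A ⊗[ℂ] B →⋆ₐ[ℂ] C) [Fact (DenseRange φ)]
  {M : Type v₁} [NormedAddCommGroup M] [NormedSpace ℂ M] [Module A M] [CStarModule A M]
  {N : Type v₂} [NormedAddCommGroup N] [NormedSpace ℂ N] [Module B N] [CStarModule B N]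
  {Ω : Type w} [MeasurableSpace Ω]

/-- The map `(ω₁, ω₂) ↦ X₁ ω₁ ⊗ X₂ ω₂` on a product space. -/
def tensorFun {Ω₁ Ω₂ : Type*} (X₁ : Ω₁ → M) (X₂ : Ω₂ → N) : Ω₁ × Ω₂ → HilbertTensor φ M N :=
  fun ω => HilbertTensor.tmul φ (X₁ ω.1) (X₂ ω.2)

variable (M N) in
/-- The set of elementary tensors `x ⊗ y`. -/
def HilbertTensor.elementary : Set (HilbertTensor φ M N) :=
  Set.range fun p : M × N => HilbertTensor.tmul φ p.1 p.2

/-- A continuous biframe for a tensor product of Hilbert modules. -/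
def IsTensorBiframe (X Y : Ω → HilbertTensor φ M N) (μ : Measure Ω) : Prop :=
  IsBiframeOn C (HilbertTensor.elementary φ M N) X Y μ

/-- The bounded operator `S` is the biframe operator of `(X, Y)` on a tensor product of Hilbert
modules: `S (f ⊗ g) = ∫ ⟨f ⊗ g, X ω⟩ Y ω dμ(ω)` on elementary tensors, extended linearly and
continuously. -/
def IsTensorBiframeOperator (X Y : Ω → HilbertTensor φ M N) (μ : Measure Ω)
    (S : HilbertTensor φ M N →L[ℂ] HilbertTensor φ M N) : Prop :=
  IsBiframeOperatorOn C (HilbertTensor.elementary φ M N) X Y μ S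

/-- The bounded operator `T` is the tensor product of `S₁` and `S₂`:
`T (x ⊗ y) = S₁ x ⊗ S₂ y`. -/
def IsTensorMap (S₁ : M → M) (S₂ : N → N)
    (T : HilbertTensor φ M N →L[ℂ] HilbertTensor φ M N) : Prop :=
  ∀ x y, T (HilbertTensor.tmul φ x y) = HilbertTensor.tmul φ (S₁ x) (S₂ y)

theorem IsTensorMap.unique {S₁ : M → M} {S₂ : N → N}
    {T T' : HilbertTensor φ M N →L[ℂ] HilbertTensor φ M N}
    (h : IsTensorMap φ S₁ S₂ T) (h' : IsTensorMap φ S₁ S₂ T') : T = T' := by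
  refine HilbertTensor.ext_ι fun z => ?_
  have key : (T : HilbertTensor φ M N →ₗ[ℂ] HilbertTensor φ M N) ∘ₗ HilbertTensor.ι φ M N =
      (T' : HilbertTensor φ M N →ₗ[ℂ] HilbertTensor φ M N) ∘ₗ HilbertTensor.ι φ M N :=
    TensorProduct.ext' (R := ℂ) fun x y => (h x y).trans (h' x y).symm
  exact LinearMap.congr_fun key z

end BiframeTensor

end

/-! On elementary tensors the integrand separates. The product `⟨f ⊗ g, X⟩⟨Y, f' ⊗ g'⟩` is `φ (u ⊗
v)`, where `u = ⟨f, X₁⟩⟨Y₁, f'⟩` depends only on the first variable and `v = ⟨g, X₂⟩⟨Y₂, g'⟩` only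
on the second. Fubini turns its integral into `φ (⟨S₁ f, f'⟩ ⊗ ⟨S₂ g, g'⟩)`, which is `⟨S₁ f ⊗ S₂ g,
f' ⊗ g'⟩`. Uniqueness holds because elementary tensors span a dense subspace.

Two points need work. The first is that `S₁ ⊗ S₂` is bounded on the completion. The `Sᵢ` are given
only as maps, but the weak formula makes them module maps, and the closed graph theorem, applied to
the integrand as an `L¹`-valued map and then to `Sᵢ`, makes them bounded
(`IsBiframeOperator.exists_clm`). No adjoint is used: a bounded module map satisfies Paschke's
inequality `⟨S x, S x⟩ ≤ ‖S‖ ^ 2 ⟨x, x⟩` (`CStarModule.inner_map_self_le`), hence a matrix version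
(`CStarModule.gram_sub_factor`). Tensoring that positive matrix entrywise with the Gram matrix of
the other leg, as in the Schur product theorem, bounds `S ⊗ 1` and `1 ⊗ S` by `‖S‖`.

The second point is Fubini without σ-finiteness (`integral_mul_of_product_measure`): an integrable
function vanishes off a σ-finite set, and on the rectangle of two such sets the measure is the usual
product measure. -/

/-! ### Paschke's inequality for bounded module maps and its matrix form. -/

section ModuleMap

variable {A : Type*} [CStarAlgebra A] [PartialOrder A] [StarOrderedRing A]
variable {M : Type*} [NormedAddCommGroup M] [NormedSpace ℂ M] [Module A M] [CStarModule A M]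

/-- A bounded module map satisfies `⟨S x, S x⟩ ≤ ‖S‖ ^ 2 ⟨x, x⟩`. -/
theorem CStarModule.inner_map_self_le (S : M →L[ℂ] M) (hS : ∀ (a : A) (x : M), S (a • x) = a • S x)
    (x : M) : inner A (S x) (S x) ≤ ‖S‖ ^ 2 • inner A x x := by
  -- `⟨x, x⟩` need not be invertible; adding `ε` makes it so, and `h = b ^ (-1/2)` then scales `x`
  -- into the unit ball. The operator norm bounds `S (h • x) = h • S x`, and conjugation by `k =
  -- h⁻¹` recovers `⟨S x, S x⟩`.
  have key : ∀ ε : ℝ, 0 < ε →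
      inner A (S x) (S x) ≤ ‖S‖ ^ 2 • (inner A x x + algebraMap ℝ A ε) := by
    intro ε hε
    have hx0 : 0 ≤ inner A x x := CStarModule.inner_self_nonneg
    set b : A := inner A x x + algebraMap ℝ A ε with hb
    have hεb : algebraMap ℝ A ε ≤ b := le_add_of_nonneg_left hx0
    have hεp : IsStrictlyPositive (algebraMap ℝ A ε) :=
      IsStrictlyPositive.iff_of_unital.2 ⟨algebraMap_nonneg A hε.le,
        (isUnit_iff_ne_zero.2 hε.ne').map (algebraMap ℝ A)⟩
    have hbp : IsStrictlyPositive b := hεp.of_le hεb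
    set h : A := b ^ (-(1 / 2) : ℝ) with hh
    have hhs : star h = h := (IsSelfAdjoint.of_nonneg CFC.rpow_nonneg).star_eq
    have h1 : h * b * h = 1 := CFC.conjugate_rpow_neg_one_half b
    set k : A := b ^ ((1 / 2) : ℝ) with hk
    have hks : star k = k := (IsSelfAdjoint.of_nonneg CFC.rpow_nonneg).star_eq
    have hkh : k * h = 1 := by
      rw [hk, hh, ← CFC.rpow_add hbp.isUnit]; simp [CFC.rpow_zero b hbp.nonneg]
    have hhk : h * k = 1 := by
      rw [hk, hh, ← CFC.rpow_add hbp.isUnit]; simp [CFC.rpow_zero b hbp.nonneg]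
    have hkk : k * k = b := by
      rw [hk, ← CFC.rpow_add hbp.isUnit]; norm_num [CFC.rpow_one b hbp.nonneg]
    have h2 : inner A (h • x) (h • x) ≤ 1 := by
      rw [CStarModule.inner_op_smul_left, CStarModule.inner_op_smul_right, hhs, ← h1]
      have := star_right_conjugate_le_conjugate
        (show inner A x x ≤ b from le_add_of_nonneg_right (algebraMap_nonneg A hε.le)) h
      rwa [hhs] at this
    have h3 : ‖h • x‖ ^ 2 ≤ 1 := by
      rw [CStarModule.norm_sq_eq A]
      exact (CStarAlgebra.norm_le_one_iff_of_nonneg _ CStarModule.inner_self_nonneg).2 h2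
    have h4 : ‖inner A (S (h • x)) (S (h • x))‖ ≤ ‖S‖ ^ 2 := by
      rw [← CStarModule.norm_sq_eq A]
      calc ‖S (h • x)‖ ^ 2 ≤ (‖S‖ * ‖h • x‖) ^ 2 := by gcongr; exact S.le_opNorm _
        _ = ‖S‖ ^ 2 * ‖h • x‖ ^ 2 := mul_pow _ _ _
        _ ≤ ‖S‖ ^ 2 := mul_le_of_le_one_right (by positivity) h3
    have h5 : inner A (S (h • x)) (S (h • x)) ≤ algebraMap ℝ A (‖S‖ ^ 2) :=
      (CStarAlgebra.norm_le_iff_le_algebraMap _ (by positivity) CStarModule.inner_self_nonneg).1 h4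
    rw [hS, CStarModule.inner_op_smul_left, CStarModule.inner_op_smul_right, hhs] at h5
    have h6 := star_right_conjugate_le_conjugate h5 k
    rw [hks] at h6
    have e1 : k * (h * inner A (S x) (S x) * h) * k = inner A (S x) (S x) := by
      calc _ = (k * h) * inner A (S x) (S x) * (h * k) := by noncomm_ring
        _ = _ := by rw [hkh, hhk]; simp
    have e2 : k * algebraMap ℝ A (‖S‖ ^ 2) * k = ‖S‖ ^ 2 • b := by
      rw [Algebra.algebraMap_eq_smul_one, mul_smul_comm, mul_one, smul_mul_assoc, hkk]
    rwa [e1, e2] at h6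
  -- The order on `A` is closed, so the estimate survives the limit `ε → 0`.
  have hc : Filter.Tendsto (fun ε : ℝ => ‖S‖ ^ 2 • (inner A x x + algebraMap ℝ A ε))
      (nhdsWithin 0 (Set.Ioi 0)) (nhds (‖S‖ ^ 2 • (inner A x x + algebraMap ℝ A 0))) := by
    refine Filter.Tendsto.mono_left ?_ nhdsWithin_le_nhds
    refine Continuous.tendsto (f := fun ε : ℝ => ‖S‖ ^ 2 • (inner A x x + algebraMap ℝ A ε)) ?_ 0
    exact (continuous_const.add (continuous_algebraMap ℝ A)).const_smul _
  rw [map_zero, add_zero] at hc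
  exact ge_of_tendsto hc (Filter.eventually_of_mem self_mem_nhdsWithin fun ε hε => key ε hε)

/-- For a bounded module map `S`, the matrix `‖S‖ ^ 2 ⟨xᵢ, xⱼ⟩ - ⟨S xᵢ, S xⱼ⟩` is positive. -/
theorem CStarModule.gram_sub_factor (S : M →L[ℂ] M)
    (hS : ∀ (a : A) (x : M), S (a • x) = a • S x) {ι : Type*} [Fintype ι] (x : ι → M) :
    ∃ E : ι → ι → A, ∀ i j, ‖S‖ ^ 2 • inner A (x i) (x j) - inner A (S (x i)) (S (x j)) =
      ∑ k, star (E k j) * E k i := by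
  classical
  -- The indices are transposed to fit the row test `∑ a i * K i j * star (a j)`: scalars leave the
  -- second argument of `inner` on the left, and the first one starred on the right.
  let K : CStarMatrix ι ι A := CStarMatrix.ofMatrix
    (Matrix.of fun i j => ‖S‖ ^ 2 • inner A (x j) (x i) - inner A (S (x j)) (S (x i)))
  obtain ⟨E, hE⟩ : ∃ F, K = star F * F := by
    refine CStarMatrix.factor_of_rows K ?_ fun a => ?_
    · ext i j
      change star (‖S‖ ^ 2 • inner A (x i) (x j) - inner A (S (x i)) (S (x j))) =
        ‖S‖ ^ 2 • inner A (x j) (x i) - inner A (S (x j)) (S (x i))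
      simp
    · have e0 : ∀ y : ι → M, inner A (∑ j, a j • y j) (∑ i, a i • y i) =
          ∑ i, ∑ j, a i * inner A (y j) (y i) * star (a j) := by
        intro y
        simp only [CStarModule.inner_sum_left, CStarModule.inner_sum_right,
          CStarModule.inner_op_smul_right, CStarModule.inner_op_smul_left, mul_assoc,
          Finset.mul_sum]
      -- Since `S` commutes with the coefficients `a i`, testing `K` on a row is Paschke's
      -- inequality at the single vector `∑ a i • x i`.
      have e : ∑ i, ∑ j, a i * K i j * star (a j) =
          ‖S‖ ^ 2 • inner A (∑ j, a j • x j) (∑ i, a i • x i) -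
            inner A (S (∑ j, a j • x j)) (S (∑ i, a i • x i)) := by
        simp only [map_sum, hS, e0, Finset.smul_sum, ← Finset.sum_sub_distrib]
        refine Finset.sum_congr rfl fun i _ => Finset.sum_congr rfl fun j _ => ?_
        change a i * (‖S‖ ^ 2 • inner A (x j) (x i) - inner A (S (x j)) (S (x i))) * star (a j) = _
        rw [mul_sub, sub_mul, mul_smul_comm, smul_mul_assoc]
      rw [e]
      exact sub_nonneg.2 (CStarModule.inner_map_self_le S hS _)
  refine ⟨fun i j => E i j, fun i j => ?_⟩
  have : K j i = (star E * E) j i := by rw [hE]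
  rw [CStarMatrix.mul_apply] at this
  exact this

end ModuleMap

/-! ### Boundedness of the tensor product of two bounded module maps. -/

section TensorMap

variable {A : Type*} {B : Type*} {C : Type*}
  [CStarAlgebra A] [PartialOrder A] [StarOrderedRing A]
  [CStarAlgebra B] [PartialOrder B] [StarOrderedRing B]
  [CStarAlgebra C] [PartialOrder C] [StarOrderedRing C]
  (φ : A ⊗[ℂ] B →⋆ₐ[ℂ] C)

/-- The tensor product of two positive matrices, summed over all entries, is positive. -/
theorem map_sum_tmul_gram_nonneg {ι κ κ' : Type*} [Fintype ι] [Fintype κ] [Fintype κ']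
    (E : κ → ι → A) (F : κ' → ι → B) :
    0 ≤ φ (∑ i, ∑ j, (∑ k, star (E k j) * E k i) ⊗ₜ[ℂ] (∑ l, star (F l j) * F l i)) := by
  -- With `w k l = ∑ i, E k i ⊗ F l i` the double sum is `∑ k, ∑ l, star (w k l) * w k l`, a sum of
  -- squares that `φ` preserves.
  have e : ∑ i, ∑ j, (∑ k, star (E k j) * E k i) ⊗ₜ[ℂ] (∑ l, star (F l j) * F l i) =
      ∑ k, ∑ l, star (∑ j, E k j ⊗ₜ[ℂ] F l j) * (∑ i, E k i ⊗ₜ[ℂ] F l i) := by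
    simp only [star_sum, TensorProduct.star_tmul]
    simp_rw [Finset.sum_mul_sum, Algebra.TensorProduct.tmul_mul_tmul, TensorProduct.sum_tmul,
      TensorProduct.tmul_sum]
    -- Only the order of summation still differs: `i, j, k, l` has to become `k, l, j, i`.
    rw [Finset.sum_comm]
    rw [Finset.sum_congr rfl fun i _ => Finset.sum_comm]
    rw [Finset.sum_congr rfl fun i _ => Finset.sum_congr rfl fun j _ => Finset.sum_comm]
    rw [Finset.sum_comm]
    rw [Finset.sum_congr rfl fun i _ => Finset.sum_comm]
  rw [e]
  simp only [map_sum φ]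
  refine Finset.sum_nonneg fun k _ => Finset.sum_nonneg fun l _ => ?_
  rw [map_mul, map_star]
  exact star_mul_self_nonneg _

variable {M : Type*} [NormedAddCommGroup M] [NormedSpace ℂ M] [Module A M] [CStarModule A M]
  {N : Type*} [NormedAddCommGroup N] [NormedSpace ℂ N] [Module B N] [CStarModule B N]

theorem algInner_sum_tmul {ι : Type*} [Fintype ι] (x : ι → M) (y : ι → N) :
    algInner A B M N (∑ i, x i ⊗ₜ y i) (∑ i, x i ⊗ₜ y i) =
      ∑ i, ∑ j, inner A (x i) (x j) ⊗ₜ inner B (y i) (y j) := by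
  simp only [map_sum, LinearMap.sum_apply, algInner_tmul]
  rw [Finset.sum_comm]

/-- The norm of `C` is monotone on positive elements, so domination of `C`-valued inner products
passes to norms. The factor stays inside `φ`, where the Gram matrix computations below produce it.
-/
theorem PreHilbertTensor.norm_le_of_algInner_le {z w : PreHilbertTensor φ M N} {r : ℝ} (hr : 0 ≤ r)
    (h : φ (algInner A B M N w w) ≤ φ (r ^ 2 • algInner A B M N z z)) : ‖w‖ ≤ r * ‖z‖ := by
  have e : φ (r ^ 2 • algInner A B M N z z) = r ^ 2 • φ (algInner A B M N z z) :=
    LinearMap.map_smul_of_tower (φ : A ⊗[ℂ] B →ₗ[ℂ] C) (r ^ 2) _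
  rw [e, ← form_apply, ← form_apply] at h
  have h1 := CStarAlgebra.norm_le_norm_of_nonneg_of_le (form_self_nonneg φ M N w) h
  rw [norm_smul, ← norm_sq, ← norm_sq, Real.norm_of_nonneg (by positivity), ← mul_pow] at h1
  exact le_of_sq_le_sq h1 (by positivity)

/-- For `z = ∑ xᵢ ⊗ yᵢ`, the difference `‖S‖ ^ 2 ⟨z, z⟩ - ⟨(S ⊗ 1) z, (S ⊗ 1) z⟩` is the sum over
`i, j` of the defect matrix of `S` at the `xᵢ` tensored entrywise with the Gram matrix of the `yᵢ`.
Both matrices factor as `E* E`, so `φ` of this sum is positive. -/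
theorem PreHilbertTensor.norm_rTensor_le (S : M →L[ℂ] M)
    (hS : ∀ (a : A) (x : M), S (a • x) = a • S x) (z : PreHilbertTensor φ M N) :
    norm (E := PreHilbertTensor φ M N) (LinearMap.rTensor N (S : M →ₗ[ℂ] M) z) ≤ ‖S‖ * ‖z‖ := by
  refine PreHilbertTensor.norm_le_of_algInner_le φ (norm_nonneg S) ?_
  obtain ⟨s, rfl⟩ := TensorProduct.exists_finset z
  obtain ⟨E, hE⟩ := CStarModule.gram_sub_factor (A := A) S hS (fun i : s => i.1.1)
  obtain ⟨F, hF⟩ := CStarModule.gram_factor (A := B) (fun i : s => i.1.2)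
  have h := map_sum_tmul_gram_nonneg φ E F
  simp only [← hE, ← hF, TensorProduct.sub_tmul, Finset.sum_sub_distrib, map_sub,
    ← TensorProduct.smul_tmul', ← Finset.smul_sum] at h
  rw [← Finset.sum_coe_sort s, map_sum (LinearMap.rTensor N (S : M →ₗ[ℂ] M))]
  simp only [LinearMap.rTensor_tmul, ContinuousLinearMap.coe_coe, algInner_sum_tmul]
  exact sub_nonneg.1 h

theorem PreHilbertTensor.norm_lTensor_le (S : N →L[ℂ] N)
    (hS : ∀ (b : B) (y : N), S (b • y) = b • S y) (z : PreHilbertTensor φ M N) :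
    norm (E := PreHilbertTensor φ M N) (LinearMap.lTensor M (S : N →ₗ[ℂ] N) z) ≤ ‖S‖ * ‖z‖ := by
  refine PreHilbertTensor.norm_le_of_algInner_le φ (norm_nonneg S) ?_
  obtain ⟨s, rfl⟩ := TensorProduct.exists_finset z
  obtain ⟨E, hE⟩ := CStarModule.gram_factor (A := A) (fun i : s => i.1.1)
  obtain ⟨F, hF⟩ := CStarModule.gram_sub_factor (A := B) S hS (fun i : s => i.1.2)
  have h := map_sum_tmul_gram_nonneg φ E F
  simp only [← hE, ← hF, TensorProduct.tmul_sub, Finset.sum_sub_distrib, map_sub,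
    TensorProduct.tmul_smul, ← Finset.smul_sum] at h
  rw [← Finset.sum_coe_sort s, map_sum (LinearMap.lTensor M (S : N →ₗ[ℂ] N))]
  simp only [LinearMap.lTensor_tmul, ContinuousLinearMap.coe_coe, algInner_sum_tmul]
  exact sub_nonneg.1 h

/-- Bounded module maps `S₁` and `S₂` have a bounded tensor product. -/
theorem exists_isTensorMap (S₁ : M →L[ℂ] M) (S₂ : N →L[ℂ] N)
    (h₁ : ∀ (a : A) (x : M), S₁ (a • x) = a • S₁ x)
    (h₂ : ∀ (b : B) (y : N), S₂ (b • y) = b • S₂ y) :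
    ∃ T : HilbertTensor φ M N →L[ℂ] HilbertTensor φ M N, IsTensorMap φ S₁ S₂ T := by
  -- Writing `S₁ ⊗ S₂ = (S₁ ⊗ 1)(1 ⊗ S₂)` lets each leg be estimated separately. The resulting bound
  -- also makes the map descend to the separated completion.
  let L : PreHilbertTensor φ M N →ₗ[ℂ] PreHilbertTensor φ M N :=
    LinearMap.rTensor N (S₁ : M →ₗ[ℂ] M) ∘ₗ LinearMap.lTensor M (S₂ : N →ₗ[ℂ] N)
  have hL : ∀ z, ‖(HilbertTensor.ι φ M N ∘ₗ L) z‖ ≤ ‖S₁‖ * ‖S₂‖ * ‖HilbertTensor.ι φ M N z‖ := by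
    intro z
    rw [LinearMap.comp_apply, HilbertTensor.norm_ι, HilbertTensor.norm_ι, mul_assoc]
    exact (PreHilbertTensor.norm_rTensor_le φ S₁ h₁ _).trans
      (mul_le_mul_of_nonneg_left (PreHilbertTensor.norm_lTensor_le φ S₂ h₂ z) (norm_nonneg _))
  refine ⟨(HilbertTensor.ι φ M N ∘ₗ L).extendOfNorm (HilbertTensor.ι φ M N), fun x y => ?_⟩
  exact LinearMap.extendOfNorm_eq (HilbertTensor.denseRange_ι φ M N) ⟨_, hL⟩ _

end TensorMap

/-! ### Fubini for products of integrable functions, without σ-finiteness. -/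

section ProductMeasure

variable {α β : Type*} [MeasurableSpace α] [MeasurableSpace β] {μ : Measure α} {ν : Measure β}
  {R : Type*} [NormedRing R] [NormedAlgebra ℝ R]

/-- If the integrals of `f` and `g` exist, the integral of `f x * g y` over a measure with
`ρ (s ×ˢ t) = μ s * ν t` is their product; the measures need not be σ-finite. -/
theorem integral_mul_of_product_measure [CompleteSpace R] {ρ : Measure (α × β)}
    (hρ : ∀ (s : Set α) (t : Set β), MeasurableSet s → MeasurableSet t →
      ρ (s ×ˢ t) = μ s * ν t)
    {f : α → R} {g : β → R} (hf : Integrable f μ) (hg : Integrable g ν) :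
    Integrable (fun z : α × β => f z.1 * g z.2) ρ ∧
      ∫ z, f z.1 * g z.2 ∂ρ = (∫ x, f x ∂μ) * ∫ y, g y ∂ν := by
  -- `f` and `g` vanish almost everywhere off `s` and `t`, on which `μ` and `ν` are σ-finite.
  obtain ⟨s, hs, hfs, hσs⟩ := hf.aefinStronglyMeasurable.exists_set_sigmaFinite
  obtain ⟨t, ht, hgt, hσt⟩ := hg.aefinStronglyMeasurable.exists_set_sigmaFinite
  -- A null set `u` has a null cylinder even if `ν` is infinite, because `0 * ∞ = 0` in `ℝ≥0∞`.
  -- Almost everywhere statements in one variable thus lift to `ρ`.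
  have hfst : Measure.QuasiMeasurePreserving Prod.fst ρ μ := by
    refine ⟨measurable_fst, Measure.AbsolutelyContinuous.mk fun u hu h0 => ?_⟩
    rw [Measure.map_apply measurable_fst hu, ← Set.prod_univ, hρ _ _ hu .univ, h0, zero_mul]
  have hsnd : Measure.QuasiMeasurePreserving Prod.snd ρ ν := by
    refine ⟨measurable_snd, Measure.AbsolutelyContinuous.mk fun u hu h0 => ?_⟩
    rw [Measure.map_apply measurable_snd hu, ← Set.univ_prod, hρ _ _ .univ hu, h0, mul_zero]
  have hfs' : ∀ᵐ x ∂μ, x ∉ s → f x = 0 := (ae_restrict_iff' hs.compl).1 hfs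
  have hgt' : ∀ᵐ y ∂ν, y ∉ t → g y = 0 := (ae_restrict_iff' ht.compl).1 hgt
  have hz : ∀ᵐ z ∂ρ, z ∉ s ×ˢ t → f z.1 * g z.2 = 0 := by
    filter_upwards [hfst.ae hfs', hsnd.ae hgt'] with z h1 h2 hz
    by_cases h : z.1 ∈ s
    · rw [h2 fun h' => hz ⟨h, h'⟩, mul_zero]
    · rw [h1 h, zero_mul]
  -- Both restrictions are σ-finite, so the values on rectangles determine the measure.
  have hprod : (μ.restrict s).prod (ν.restrict t) = ρ.restrict (s ×ˢ t) := by
    refine Measure.prod_eq fun u v hu hv => ?_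
    rw [Measure.restrict_apply (hu.prod hv), Set.prod_inter_prod,
      hρ _ _ (hu.inter hs) (hv.inter ht), Measure.restrict_apply hu, Measure.restrict_apply hv]
  have hint : IntegrableOn (fun z : α × β => f z.1 * g z.2) (s ×ˢ t) ρ := by
    rw [IntegrableOn, ← hprod]
    exact hf.restrict.mul_prod hg.restrict
  refine ⟨hint.integrable_of_ae_notMem_eq_zero hz, ?_⟩
  rw [← setIntegral_eq_integral_of_ae_compl_eq_zero hz, ← hprod, integral_prod,
    ← setIntegral_eq_integral_of_ae_compl_eq_zero hfs',
    ← setIntegral_eq_integral_of_ae_compl_eq_zero hgt', ← integral_mul_const_of_integrable hf.restrict]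
  -- `R` may be noncommutative: `f x` leaves the inner integral on the left, and the integral of `g`
  -- was pulled out of the outer one on the right.
  · exact integral_congr_ae (.of_forall fun x =>
      (integral_const_mul_of_integrable hg.restrict :
        ∫ y in t, f x * g y ∂ν = f x * ∫ y in t, g y ∂ν))
  · rw [hprod]; exact hint

end ProductMeasure

/-! ### Continuous dependence of integrals on a parameter, by the closed graph theorem. -/

section ClosedGraph

variable {F E : Type*} [NormedAddCommGroup F] [NormedSpace ℂ F] [CompleteSpace F]
  [NormedAddCommGroup E] [NormedSpace ℂ E] [CompleteSpace E]
  {Ω : Type*} [MeasurableSpace Ω] {μ : Measure Ω}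

/-- The integral of a function depending linearly and pointwise continuously on a parameter in a
Banach space depends continuously on the parameter. -/
theorem continuous_integral_of_linear (L : F →ₗ[ℂ] Ω → E) (hc : ∀ ω, Continuous fun f => L f ω)
    (hi : ∀ f, Integrable (L f) μ) : Continuous fun f => ∫ ω, L f ω ∂μ := by
  let Φ : F →ₗ[ℂ] Lp E 1 μ :=
    { toFun := fun f => (hi f).toL1
      map_add' := fun f g => by
        rw [← Integrable.toL1_add]; congr 1; exact map_add L f g
      map_smul' := fun c f => by
        rw [RingHom.id_apply, ← Integrable.toL1_smul]; congr 1; exact map_smul L c f }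
  have hΦ : Continuous Φ := by
    -- If `Φ (u n) → y` in `L¹`, a subsequence converges almost everywhere to `y`; pointwise
    -- continuity of `L` forces the same limit to be `L x`.
    refine Φ.continuous_of_seq_closed_graph fun u x y hu hy => ?_
    obtain ⟨ns, hns, hlim⟩ := (tendstoInMeasure_of_tendsto_Lp hy).exists_seq_tendsto_ae
    refine Lp.ext ?_
    have h1 : ∀ᵐ ω ∂μ, ∀ n, Φ (u n) ω = L (u n) ω :=
      ae_all_iff.2 fun n => (hi (u n)).coeFn_toL1
    filter_upwards [hlim, h1, (hi x).coeFn_toL1] with ω h2 h3 h4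
    refine Eq.trans ?_ h4.symm
    refine tendsto_nhds_unique h2 ?_
    simp only [Function.comp_apply, h3]
    exact ((hc ω).tendsto x).comp (hu.comp hns.tendsto_atTop)
  have e : (fun f => ∫ ω, L f ω ∂μ) = fun f => ∫ ω, Φ f ω ∂μ :=
    funext fun f => (integral_congr_ae (hi f).coeFn_toL1).symm
  rw [e]
  exact continuous_integral.comp hΦ

end ClosedGraph

/-! ### Boundedness and module linearity of biframe operators. -/

section BiframeOperator

variable {A : Type*} [CStarAlgebra A] [PartialOrder A] [StarOrderedRing A]
  {M : Type*} [NormedAddCommGroup M] [NormedSpace ℂ M] [CompleteSpace M]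
  [Module A M] [CStarModule A M] {Ω : Type*} [MeasurableSpace Ω] {μ : Measure Ω}
  {X Y : Ω → M} {S : M → M}

/-- `lip` reverses the arguments of `inner`, so the scalar `⟨f, X ω⟩` comes out on the left. In this
form the dependence on `f` sits in the left factor alone, where it is linear. -/
theorem IsBiframeOperator.integrable (hS : IsBiframeOperator A X Y μ S) (f g : M) :
    Integrable (fun ω => inner A (X ω) f * inner A g (Y ω)) μ := by
  have h := (hS f trivial g trivial).1
  simpa only [lip, CStarModule.inner_op_smul_right] using h

theorem IsBiframeOperator.inner_apply (hS : IsBiframeOperator A X Y μ S) (f g : M) :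
    inner A g (S f) = ∫ ω, inner A (X ω) f * inner A g (Y ω) ∂μ := by
  have h := (hS f trivial g trivial).2
  simpa only [lip, CStarModule.inner_op_smul_right] using h

/-- A biframe operator that exists as a weak integral is a bounded module map. -/
theorem IsBiframeOperator.exists_clm (hS : IsBiframeOperator A X Y μ S) :
    ∃ S' : M →L[ℂ] M, ⇑S' = S ∧ ∀ (a : A) (x : M), S' (a • x) = a • S' x := by
  let S₀ : M →ₗ[ℂ] M :=
    { toFun := S
      map_add' := fun f f' => CStarModule.ext_inner (A := A) fun g => by
        simp only [CStarModule.inner_add_right, hS.inner_apply, add_mul]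
        exact integral_add (hS.integrable f g) (hS.integrable f' g)
      map_smul' := fun c f => CStarModule.ext_inner (A := A) fun g => by
        simp only [CStarModule.inner_smul_right_complex, hS.inner_apply, smul_mul_assoc,
          RingHom.id_apply]
        exact integral_smul c _ }
  have hc : Continuous S₀ := by
    refine S₀.continuous_of_seq_closed_graph fun u x y hu hy => ?_
    refine CStarModule.ext_inner (A := A) fun g => ?_
    let L : M →ₗ[ℂ] Ω → A :=
      { toFun := fun f ω => inner A (X ω) f * inner A g (Y ω)
        map_add' := fun f f' => by ext ω; simp [add_mul]
        map_smul' := fun c f => by ext ω; simp }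
    -- Weak continuity of `S` suffices for a closed graph: it identifies the limit `y` of `S (u n)`
    -- with `S x` after pairing with each `g`.
    have hL : Continuous fun f => inner A g (S f) := by
      simp only [hS.inner_apply]
      exact continuous_integral_of_linear L
        (fun ω => (CStarModule.innerSL (A := A) (X ω)).continuous.mul continuous_const)
        fun f => hS.integrable f g
    exact tendsto_nhds_unique
      (((CStarModule.innerSL (A := A) g).continuous.tendsto y).comp hy)
      ((hL.tendsto x).comp hu)
  refine ⟨⟨S₀, hc⟩, rfl, fun a f => CStarModule.ext_inner (A := A) fun g => ?_⟩
  change inner A g (S (a • f)) = inner A g (a • S f)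
  -- The scalar `a` is the leftmost factor of the integrand, hence leaves the integral.
  simp only [CStarModule.inner_op_smul_right, hS.inner_apply, mul_assoc]
  exact integral_const_mul_of_integrable (hS.integrable f g)

end BiframeOperator

/-! ### The biframe operator on the tensor product, for a general `φ`. -/

section TensorBiframeOperator

variable {A : Type*} {B : Type*} {C : Type*}
  [CStarAlgebra A] [PartialOrder A] [StarOrderedRing A]
  [CStarAlgebra B] [PartialOrder B] [StarOrderedRing B]
  [CStarAlgebra C] [PartialOrder C] [StarOrderedRing C]
  (φ : A ⊗[ℂ] B →⋆ₐ[ℂ] C)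

/-- The continuous map `a ↦ φ (a ⊗ 1)`. -/
noncomputable def mapLeft : A →L[ℂ] C :=
  let ψ : A →⋆ₐ[ℂ] C :=
    { toAlgHom := (φ : A ⊗[ℂ] B →ₐ[ℂ] C).comp Algebra.TensorProduct.includeLeft
      map_star' := fun a => by
        change φ (star a ⊗ₜ 1) = star (φ (a ⊗ₜ 1))
        rw [← map_star, TensorProduct.star_tmul, star_one] }
  -- A ⋆-homomorphism between C⋆-algebras is automatically continuous.
  ⟨(ψ : A →ₗ[ℂ] C), map_continuous ψ⟩

/-- The continuous map `b ↦ φ (1 ⊗ b)`. -/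
noncomputable def mapRight : B →L[ℂ] C :=
  let ψ : B →⋆ₐ[ℂ] C :=
    { toAlgHom := (φ : A ⊗[ℂ] B →ₐ[ℂ] C).comp Algebra.TensorProduct.includeRight
      map_star' := fun b => by
        change φ (1 ⊗ₜ star b) = star (φ (1 ⊗ₜ b))
        rw [← map_star, TensorProduct.star_tmul, star_one] }
  ⟨(ψ : B →ₗ[ℂ] C), map_continuous ψ⟩

/-- No norm is fixed on the algebraic tensor product, so `φ` cannot be moved through a Bochner
integral directly. Its two legs are continuous and can, and what remains is a product of `C`-valued
functions. -/
theorem map_tmul_eq (a : A) (b : B) : φ (a ⊗ₜ b) = mapLeft φ a * mapRight φ b := by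
  change φ (a ⊗ₜ b) = φ (a ⊗ₜ 1) * φ (1 ⊗ₜ b)
  rw [← map_mul, Algebra.TensorProduct.tmul_mul_tmul, mul_one, one_mul]

/-- Integration of `φ (f x ⊗ g y)` over a product measure. -/
theorem integral_map_tmul {α β : Type*} [MeasurableSpace α] [MeasurableSpace β] {μ : Measure α}
    {ν : Measure β} {ρ : Measure (α × β)}
    (hρ : ∀ (s : Set α) (t : Set β), MeasurableSet s → MeasurableSet t →
      ρ (s ×ˢ t) = μ s * ν t)
    {f : α → A} {g : β → B} (hf : Integrable f μ) (hg : Integrable g ν) :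
    Integrable (fun z : α × β => φ (f z.1 ⊗ₜ g z.2)) ρ ∧
      ∫ z, φ (f z.1 ⊗ₜ g z.2) ∂ρ = φ ((∫ x, f x ∂μ) ⊗ₜ ∫ y, g y ∂ν) := by
  simp only [map_tmul_eq, ← ContinuousLinearMap.integral_comp_comm _ hf,
    ← ContinuousLinearMap.integral_comp_comm _ hg]
  exact integral_mul_of_product_measure hρ ((mapLeft φ).integrable_comp hf)
    ((mapRight φ).integrable_comp hg)

variable [Fact (DenseRange φ)]
  {M : Type*} [NormedAddCommGroup M] [NormedSpace ℂ M] [Module A M] [CStarModule A M]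
  {N : Type*} [NormedAddCommGroup N] [NormedSpace ℂ N] [Module B N] [CStarModule B N]

/-- Bounded operators on a tensor product agree if they agree weakly on elementary tensors. -/
theorem HilbertTensor.ext_elementary {S T : HilbertTensor φ M N →L[ℂ] HilbertTensor φ M N}
    (h : ∀ x y x' y', inner C (tmul φ x' y') (S (tmul φ x y)) =
      inner C (tmul φ x' y') (T (tmul φ x y))) : S = T := by
  have h1 : ∀ x y, S (tmul φ x y) = T (tmul φ x y) := by
    intro x y
    -- Pairings with elementary tensors determine a vector, since their span is dense and the form
    -- is continuous; the same density then extends equality from elementary tensors to all of the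
    -- module.
    refine ext_form φ M N fun v => ?_
    refine (denseRange_ι φ M N).induction_on v
      (isClosed_eq (continuous_form φ M N continuous_id continuous_const)
        (continuous_form φ M N continuous_id continuous_const)) fun z => ?_
    induction z using TensorProduct.induction_on with
    | zero => rw [show ι φ M N (0 : M ⊗[ℂ] N) = 0 from map_zero _]; simp
    | tmul x' y' => exact h x y x' y'
    | add z w hz hw =>
      rw [show ι φ M N (z + w : M ⊗[ℂ] N) = ι φ M N z + ι φ M N w from map_add _ _ _]
      simp only [map_add, add_apply, hz, hw]
  refine ext_ι fun z => ?_
  have key : (S : HilbertTensor φ M N →ₗ[ℂ] HilbertTensor φ M N) ∘ₗ ι φ M N =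
      (T : HilbertTensor φ M N →ₗ[ℂ] HilbertTensor φ M N) ∘ₗ ι φ M N :=
    TensorProduct.ext' (R := ℂ) h1
  exact LinearMap.congr_fun key z

/-- The tensor product of two biframe operators exists, and it is the unique biframe operator of
the tensor product. -/
theorem exists_isTensorMap_biframeOperator [CompleteSpace M] [CompleteSpace N]
    {Ω₁ Ω₂ : Type*} [MeasurableSpace Ω₁] [MeasurableSpace Ω₂]
    {μ₁ : Measure Ω₁} {μ₂ : Measure Ω₂} {μ : Measure (Ω₁ × Ω₂)}
    (hμ : ∀ (s : Set Ω₁) (t : Set Ω₂), MeasurableSet s → MeasurableSet t →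
      μ (s ×ˢ t) = μ₁ s * μ₂ t)
    {X₁ Y₁ : Ω₁ → M} {X₂ Y₂ : Ω₂ → N} {S₁ : M → M} {S₂ : N → N}
    (hS₁ : IsBiframeOperator A X₁ Y₁ μ₁ S₁) (hS₂ : IsBiframeOperator B X₂ Y₂ μ₂ S₂) :
    ∃ T : HilbertTensor φ M N →L[ℂ] HilbertTensor φ M N, IsTensorMap φ S₁ S₂ T ∧
      ∀ S : HilbertTensor φ M N →L[ℂ] HilbertTensor φ M N,
        IsTensorBiframeOperator φ (tensorFun φ X₁ X₂) (tensorFun φ Y₁ Y₂) μ S ↔ S = T := by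
  obtain ⟨R₁, rfl, hR₁⟩ := hS₁.exists_clm
  obtain ⟨R₂, rfl, hR₂⟩ := hS₂.exists_clm
  obtain ⟨T, hT⟩ := exists_isTensorMap φ R₁ R₂ hR₁ hR₂
  have hTop : IsTensorBiframeOperator φ (tensorFun φ X₁ X₂) (tensorFun φ Y₁ Y₂) μ T := by
    rintro _ ⟨⟨f, g⟩, rfl⟩ _ ⟨⟨f', g'⟩, rfl⟩
    -- The separated integrand `φ (u ⊗ v)`; multiplicativity of `φ` identifies it below with the
    -- product of the two inner products on the tensor product.
    have h := integral_map_tmul φ hμ (hS₁.integrable f f') (hS₂.integrable g g')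
    rw [← hS₁.inner_apply, ← hS₂.inner_apply] at h
    simp only [lip, tensorFun, CStarModule.inner_op_smul_right, hT f g, HilbertTensor.inner_tmul,
      ← map_mul, Algebra.TensorProduct.tmul_mul_tmul]
    exact ⟨h.1, h.2.symm⟩
  refine ⟨T, hT, fun S => ⟨fun hS => HilbertTensor.ext_elementary φ fun x y x' y' => ?_, ?_⟩⟩
  -- The pairings of `S` and `T` equal the same integral.
  · exact (hS _ ⟨(x, y), rfl⟩ _ ⟨(x', y'), rfl⟩).2.trans
      (hTop _ ⟨(x, y), rfl⟩ _ ⟨(x', y'), rfl⟩).2.symm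
  · rintro rfl
    exact hTop

end TensorBiframeOperator

/-- Both tensor products are `HilbertTensor φ` for a ⋆-homomorphism `φ` of dense range: the
inclusion into the spatial tensor product, or multiplication when `A` is commutative. The general
result covers both. -/
theorem mainTheorem3
    {A : Type*} [CStarAlgebra A] [PartialOrder A] [StarOrderedRing A]
    {M₁ : Type*} [NormedAddCommGroup M₁] [NormedSpace ℂ M₁] [CompleteSpace M₁]
    [Module A M₁] [CStarModule A M₁]
    {M₂ : Type*} [NormedAddCommGroup M₂] [NormedSpace ℂ M₂] [CompleteSpace M₂]
    [Module A M₂] [CStarModule A M₂]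
    {Ω₁ Ω₂ : Type*} [MeasurableSpace Ω₁] [MeasurableSpace Ω₂]
    (μ₁ : Measure Ω₁) (μ₂ : Measure Ω₂) (μ : Measure (Ω₁ × Ω₂))
    (hμ : ∀ (s : Set Ω₁) (t : Set Ω₂), MeasurableSet s → MeasurableSet t →
      μ (s ×ˢ t) = μ₁ s * μ₂ t)
    (X₁ Y₁ : Ω₁ → M₁) (X₂ Y₂ : Ω₂ → M₂) (S₁ : M₁ → M₁) (S₂ : M₂ → M₂)
    (hS₁ : IsBiframeOperator A X₁ Y₁ μ₁ S₁) (hS₂ : IsBiframeOperator A X₂ Y₂ μ₂ S₂) :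
    (IsTensorBiframe (SpatialTensor.coeHom A A)
        (tensorFun (SpatialTensor.coeHom A A) X₁ X₂)
        (tensorFun (SpatialTensor.coeHom A A) Y₁ Y₂) μ →
      ∃ T : ExteriorTensor A M₁ M₂ →L[ℂ] ExteriorTensor A M₁ M₂,
        IsTensorMap (SpatialTensor.coeHom A A) S₁ S₂ T ∧
        ∀ S : ExteriorTensor A M₁ M₂ →L[ℂ] ExteriorTensor A M₁ M₂,
          IsTensorBiframeOperator (SpatialTensor.coeHom A A)
            (tensorFun (SpatialTensor.coeHom A A) X₁ X₂)
            (tensorFun (SpatialTensor.coeHom A A) Y₁ Y₂) μ S ↔ S = T) ∧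
    (∀ hA : ∀ a b : A, a * b = b * a,
      IsTensorBiframe (mulHom hA) (tensorFun (mulHom hA) X₁ X₂) (tensorFun (mulHom hA) Y₁ Y₂) μ →
      ∃ T : BalancedTensor M₁ M₂ hA →L[ℂ] BalancedTensor M₁ M₂ hA,
        IsTensorMap (mulHom hA) S₁ S₂ T ∧
        ∀ S : BalancedTensor M₁ M₂ hA →L[ℂ] BalancedTensor M₁ M₂ hA,
          IsTensorBiframeOperator (mulHom hA)
            (tensorFun (mulHom hA) X₁ X₂) (tensorFun (mulHom hA) Y₁ Y₂) μ S ↔ S = T) :=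
  ⟨fun _ => exists_isTensorMap_biframeOperator _ hμ hS₁ hS₂,
    fun _ _ => exists_isTensorMap_biframeOperator _ hμ hS₁ hS₂⟩
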